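/- **Setting.** Consider a two-player zero-sum discounted Markov game with finite non-empty state space $\mathcal S$ ($|\mathcal S|=S\ge1$), $A\ge1$ actions of the min-player, $B\ge1$ actions of the max-player, transition kernel $P(s'\mid s,a,b)$, rewards $R_s(a,b)\in[0,1]$ and discount factor $\gamma\in[0,1)$. Policies are $x=(x_s)_s\in\mathcal X=(\Delta_A)^S$ and $y=(y_s)_s\in\mathcal Y=(\Delta_B)^S$, where $\Delta_n$ is the probability simplex in $\mathbb R^n$. Put $V^{x,y}(s)=\mathbb E_{x,y}[\sum_{t\ge0}\gamma^tR_{s^t}(a^t,b^t)\mid s^0=s]$, $V^{x,\dagger}(s)=\max_{y'}V^{x,y'}(s)$, $V^{\dagger,y}(s)=\min_{x'}V^{x',y}(s)$, $v^*(s)=\min_x\max_yV^{x,y}(s)$. For $v\in\mathbb R^S$ let $Q_s[v]\in\mathbb R^{A\times B}$, $Q_s[v](a,b)=R_s(a,b)+\gamma\sum_{s'}P(s'\mid s,a,b)v(s')$, and $Q^*_s=Q_s[v^*]$. Let $X^*_s=\operatorname{argmin}_{u\in\Delta_A}\max_{w\in\Delta_B}\langle u,Q^*_sw\rangle$, $Y^*_s=\operatorname{argmax}_{w\in\Delta_B}\min_{u\in\Delta_A}\langle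 u,Q^*_sw\rangle$, $Z^*_s=X^*_s\times Y^*_s$, and $Z^*=\prod_sZ^*_s$ (the set of Nash equilibria). Distances are Euclidean, in $\mathbb R^{A+B}$ and $\mathbb R^{(A+B)S}$ respectively. **Averaging OGDA.** Let $H=\frac{1+\gamma}{1-\gamma}$, $\alpha_t=\frac{H+1}{H+t}$, $\alpha_t^j=\alpha_j\prod_{k=j+1}^t(1-\alpha_k)$ for $1\le j\le t$ (so $\alpha^t_t=\alpha_t$). Given integers $0\le T_1<T_2$, an initial pair $\hat z=(\hat x,\hat y)\in\mathcal X\times\mathcal Y$ and a stepsize $\eta'>0$, set $\tilde x^{T_1}=x^{T_1}=\hat x$, $\tilde y^{T_1}=y^{T_1}=\hat y$, $\underline V^{T_1}=V^{\dagger,\hat y}$, $\overline V^{T_1}=V^{\hat x,\dagger}$, and for $t=T_1+1,\dots,T_2$ and all $s$ $$\underline V^t(s)=\min_a\sum_{j=T_1}^{t-1}\alpha_{t-T_1}^{j-T_1+1}\,\underline q^j_s(a),\qquad \overline V^t(s)=\max_b\sum_{j=T_1}^{t-1}\alpha_{t-T_1}^{j-T_1+1}\,\overline q^j_s(b),$$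 $$x^t_s=\Pi_{\Delta_A}(\tilde x^{t-1}_s-\eta'\underline q^{t-1}_s),\qquad y^t_s=\Pi_{\Delta_B}(\tilde y^{t-1}_s+\eta'\overline q^{t-1}_s),$$ $$\tilde x^t_s=\Pi_{\Delta_A}(\tilde x^{t-1}_s-\eta'\underline q^{t}_s),\qquad \tilde y^t_s=\Pi_{\Delta_B}(\tilde y^{t-1}_s+\eta'\overline q^{t}_s),$$ where $\underline q^j_s=Q_s[\underline V^j]\,y^j_s$, $\overline q^j_s=Q_s[\overline V^j]^\top x^j_s$ and $\Pi$ is the Euclidean projection. The averaged policy pair is $\hat z^{[T_1:T_2]}=\sum_{t=T_1}^{T_2}\alpha_{T_2-T_1+1}^{t-T_1+1}\,(x^t,y^t)$. **Theorem.** There is an absolute constant $K>0$ such that for every such game the following holds. There is a constant $c_+>0$, depending only on the game, with $$\max_{w\in\Delta_B}\langle x_s,Q^*_sw\rangle-\min_{u\in\Delta_A}\langle u,Q^*_sy_s\rangle\ \ge\ c_+\operatorname{dist}\big((x_s,y_s),Z^*_s\big)\qquad\text{for all }(x,y)\in\mathcal X\times\mathcal Y,\ s\in\mathcal S,$$ and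 for every such $c_+$ there is a constant $C$ with $0<C\le K\,\frac{\sqrt S\,(A+B)}{c_+(1-\gamma)^6}$ such that for all integers $0\le T_1<T_2$, all initial policy pairs in $\mathcal X\times\mathcal Y$ and all $0<\eta'\le\frac{1-\gamma}{16\max\{A,B\}}$, the averaged policy pair of Averaging OGDA satisfies $$\operatorname{dist}\big(\hat z^{[T_1:T_2]},Z^*\big)\ \le\ \frac{C\,\log(T_2-T_1+1)}{\eta'\,(T_2-T_1+1)}.$$ -/

import Mathlib

open scoped BigOperators
open MeasureTheory ProbabilityTheory

noncomputable section

/-- The probability simplex of `ℝⁿ`, inside Euclidean space. -/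
def simplex (n : ℕ) : Set (EuclideanSpace ℝ (Fin n)) :=
  {x | WithLp.ofLp x ∈ stdSimplex ℝ (Fin n)}

theorem simplex_isCompact (n : ℕ) : IsCompact (simplex n) := by
  have h : simplex n = (PiLp.continuousLinearEquiv 2 ℝ (fun _ : Fin n => ℝ)).toHomeomorph ⁻¹'
      stdSimplex ℝ (Fin n) := rfl
  rw [h]
  exact (Homeomorph.isCompact_preimage _).2 (isCompact_stdSimplex ℝ (Fin n))

theorem simplex_nonempty (n : ℕ) [NeZero n] : (simplex n).Nonempty :=
  ⟨WithLp.toLp 2 (Pi.single 0 1), single_mem_stdSimplex ℝ (0 : Fin n)⟩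

theorem exists_proj_simplex {n : ℕ} [NeZero n] (v : EuclideanSpace ℝ (Fin n)) :
    ∃ p : simplex n, ∀ q : simplex n,
      ‖v - (p : EuclideanSpace ℝ (Fin n))‖ ≤ ‖v - (q : EuclideanSpace ℝ (Fin n))‖ := by
  obtain ⟨p, hp, h⟩ := (simplex_isCompact n).exists_infDist_eq_dist (simplex_nonempty n) v
  refine ⟨⟨p, hp⟩, fun q => ?_⟩
  rw [← dist_eq_norm, ← dist_eq_norm, ← h]
  exact Metric.infDist_le_dist_of_mem q.2

/-- The Euclidean projection onto the simplex: the point of the simplex nearest to `v`. -/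
def projSimplex {n : ℕ} [NeZero n] (v : EuclideanSpace ℝ (Fin n)) : simplex n :=
  Classical.choose (exists_proj_simplex v)

theorem sum_ofReal_simplex {n : ℕ} (x : simplex n) :
    ∑ i, ENNReal.ofReal ((x : EuclideanSpace ℝ (Fin n)) i) = 1 := by
  rw [← ENNReal.ofReal_sum_of_nonneg (fun i _ => x.2.1 i), x.2.2, ENNReal.ofReal_one]

/-- A point of the simplex, as a probability distribution on `Fin n`. -/
def simplexPMF {n : ℕ} (x : simplex n) : PMF (Fin n) :=
  PMF.ofFintype (fun i => ENNReal.ofReal ((x : EuclideanSpace ℝ (Fin n)) i)) (sum_ofReal_simplex x)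

/-- A (stationary, randomized) policy: for every state a mixed action. -/
abbrev Policy (nS n : ℕ) : Type := Fin nS → simplex n

/-- A two-player zero-sum discounted Markov game with `nS` states, `nA` actions of the min-player
and `nB` actions of the max-player. -/
structure MarkovGame (nS nA nB : ℕ) where
  /-- transition kernel: `P s a b` is the law of the next state -/
  P : Fin nS → Fin nA → Fin nB → simplex nS
  /-- reward of the max-player -/
  R : Fin nS → Fin nA → Fin nB → ℝ
  R_nonneg : ∀ s a b, 0 ≤ R s a b
  R_le_one : ∀ s a b, R s a b ≤ 1
  /-- discount factor -/
  γ : ℝ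
  γ_nonneg : 0 ≤ γ
  γ_lt_one : γ < 1

/-- The space of joint policy vectors `z = (z_s)_s`, `z_s = (x_s, y_s) ∈ ℝ^{A+B}`,
with the Euclidean (`ℓ²`) norm of `ℝ^{(A+B)S}`. -/
abbrev JointSpace (nS nA nB : ℕ) : Type :=
  PiLp 2 (fun _ : Fin nS => WithLp 2 (EuclideanSpace ℝ (Fin nA) × EuclideanSpace ℝ (Fin nB)))

/-- The pair `(u, w)` as a vector of `ℝ^{A+B}`. -/
def pairVec {nA nB : ℕ} (u : EuclideanSpace ℝ (Fin nA)) (w : EuclideanSpace ℝ (Fin nB)) :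
    WithLp 2 (EuclideanSpace ℝ (Fin nA) × EuclideanSpace ℝ (Fin nB)) :=
  WithLp.toLp 2 (u, w)

/-- `⟨u, M w⟩`. -/
def bilin {nA nB : ℕ} (M : Matrix (Fin nA) (Fin nB) ℝ)
    (u : EuclideanSpace ℝ (Fin nA)) (w : EuclideanSpace ℝ (Fin nB)) : ℝ :=
  ∑ a, ∑ b, u a * M a b * w b

/-- `max_{w ∈ Δ_B} ⟨u, M w⟩`. -/
def maxOver {nA nB : ℕ} (M : Matrix (Fin nA) (Fin nB) ℝ) (u : EuclideanSpace ℝ (Fin nA)) : ℝ :=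
  ⨆ w : simplex nB, bilin M u w

/-- `min_{u ∈ Δ_A} ⟨u, M w⟩`. -/
def minOver {nA nB : ℕ} (M : Matrix (Fin nA) (Fin nB) ℝ) (w : EuclideanSpace ℝ (Fin nB)) : ℝ :=
  ⨅ u : simplex nA, bilin M u w

theorem continuous_bilin {nA nB : ℕ} (M : Matrix (Fin nA) (Fin nB) ℝ) :
    Continuous (fun p : EuclideanSpace ℝ (Fin nA) × EuclideanSpace ℝ (Fin nB) =>
      bilin M p.1 p.2) := by
  unfold bilin; fun_prop

theorem continuous_maxOver {nA nB : ℕ} (M : Matrix (Fin nA) (Fin nB) ℝ) :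
    Continuous (maxOver M) := by
  have h := IsCompact.continuous_sSup (f := fun u w => bilin M u w) (simplex_isCompact nB)
    (continuous_bilin M)
  convert h using 2 with u
  rw [maxOver, sSup_image']

theorem continuous_minOver {nA nB : ℕ} (M : Matrix (Fin nA) (Fin nB) ℝ) :
    Continuous (minOver M) := by
  have h := IsCompact.continuous_sInf (f := fun w u => bilin M u w) (simplex_isCompact nA)
    ((continuous_bilin M).comp continuous_swap)
  convert h using 2 with u
  rw [minOver, sInf_image']

/-- `α_t = (H+1)/(H+t)`. -/
def alphaStep (H : ℝ) (t : ℕ) : ℝ := (H + 1) / (H + t)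

/-- `α_t^j = α_j ∏_{k=j+1}^t (1 - α_k)`; in particular `α_t^t = α_t`. -/
def alphaWeight (H : ℝ) (j t : ℕ) : ℝ :=
  alphaStep H j * ∏ k ∈ Finset.Icc (j + 1) t, (1 - alphaStep H k)

/-- The variables of Averaging OGDA at one iteration: the policies played `x, y`, the auxiliary
policies `xt, yt`, and the lower and upper value estimates. -/
structure AOGDAState (nS nA nB : ℕ) where
  x : Policy nS nA
  y : Policy nS nB
  xt : Policy nS nA
  yt : Policy nS nB
  Vlo : Fin nS → ℝ
  Vhi : Fin nS → ℝ

namespace MarkovGame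

variable {nS nA nB : ℕ} (G : MarkovGame nS nA nB)

/-- Law of the round `(s, a, b)` at the state `s`: `a ∼ x_s`, `b ∼ y_s`, independently. -/
def roundPMF (x : Policy nS nA) (y : Policy nS nB) (s : Fin nS) :
    PMF (Fin nS × Fin nA × Fin nB) :=
  (simplexPMF (x s)).bind fun a => (simplexPMF (y s)).bind fun b => PMF.pure (s, a, b)

/-- Law of the next round, given the current round `(s, a, b)`: `s' ∼ P(· | s, a, b)`, then
`a' ∼ x_{s'}`, `b' ∼ y_{s'}`. -/
def nextPMF (x : Policy nS nA) (y : Policy nS nB) (r : Fin nS × Fin nA × Fin nB) :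
    PMF (Fin nS × Fin nA × Fin nB) :=
  (simplexPMF (G.P r.1 r.2.1 r.2.2)).bind fun s' => roundPMF x y s'

/-- The transition from the history of the rounds `0, …, t` to the round `t + 1`
(it depends on the last round only). -/
def stepKernel (x : Policy nS nA) (y : Policy nS nB) (t : ℕ) :
    Kernel ((i : Finset.Iic t) → (fun _ : ℕ => Fin nS × Fin nA × Fin nB) i)
      (Fin nS × Fin nA × Fin nB) :=
  Kernel.ofFunOfCountable fun h => (G.nextPMF x y (h ⟨t, Finset.mem_Iic.2 le_rfl⟩)).toMeasure

instance (x : Policy nS nA) (y : Policy nS nB) (t : ℕ) : IsMarkovKernel (G.stepKernel x y t) :=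
  ⟨fun h => PMF.toMeasure.isProbabilityMeasure
    (G.nextPMF x y (h ⟨t, Finset.mem_Iic.2 le_rfl⟩))⟩

/-- Law of the infinite trajectory `(s^t, a^t, b^t)_t` generated by `(x, y)` from `s^0 = s`. -/
def trajLaw (x : Policy nS nA) (y : Policy nS nB) (s : Fin nS) :
    Measure (ℕ → Fin nS × Fin nA × Fin nB) :=
  Kernel.trajMeasure (X := fun _ : ℕ => Fin nS × Fin nA × Fin nB)
    (roundPMF x y s).toMeasure (G.stepKernel x y)

/-- Value function `V^{x,y}(s)`: expected cumulative discounted reward. -/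
def value (x : Policy nS nA) (y : Policy nS nB) (s : Fin nS) : ℝ :=
  ∫ ω, ∑' t : ℕ, G.γ ^ t * G.R (ω t).1 (ω t).2.1 (ω t).2.2 ∂(G.trajLaw x y s)

/-- `V^{x,†}(s) = max_y V^{x,y}(s)`. -/
def valueMax (x : Policy nS nA) (s : Fin nS) : ℝ := ⨆ y : Policy nS nB, G.value x y s

/-- `V^{†,y}(s) = min_x V^{x,y}(s)`. -/
def valueMin (y : Policy nS nB) (s : Fin nS) : ℝ := ⨅ x : Policy nS nA, G.value x y s

/-- Minimax game value `v*(s) = min_x max_y V^{x,y}(s)`. -/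
def gameValue (s : Fin nS) : ℝ := ⨅ x : Policy nS nA, G.valueMax x s

/-- Bellman target operator `Q_s[v](a,b) = R_s(a,b) + γ ∑_{s'} P(s'|s,a,b) v(s')`. -/
def bellman (v : Fin nS → ℝ) (s : Fin nS) : Matrix (Fin nA) (Fin nB) ℝ :=
  Matrix.of fun a b =>
    G.R s a b + G.γ * ∑ s', (G.P s a b : EuclideanSpace ℝ (Fin nS)) s' * v s'

/-- Minimax Q-function `Q*_s = Q_s[v*]`. -/
def qStar (s : Fin nS) : Matrix (Fin nA) (Fin nB) ℝ := G.bellman G.gameValue s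

/-- `X*_s = argmin_{u ∈ Δ_A} max_{w ∈ Δ_B} ⟨u, Q*_s w⟩`. -/
def xStar (s : Fin nS) : Set (EuclideanSpace ℝ (Fin nA)) :=
  {u | u ∈ simplex nA ∧ IsMinOn (maxOver (G.qStar s)) (simplex nA) u}

/-- `Y*_s = argmax_{w ∈ Δ_B} min_{u ∈ Δ_A} ⟨u, Q*_s w⟩`. -/
def yStar (s : Fin nS) : Set (EuclideanSpace ℝ (Fin nB)) :=
  {w | w ∈ simplex nB ∧ IsMaxOn (minOver (G.qStar s)) (simplex nB) w}

/-- `Z*_s = X*_s × Y*_s`. -/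
def zStarAt (s : Fin nS) :
    Set (WithLp 2 (EuclideanSpace ℝ (Fin nA) × EuclideanSpace ℝ (Fin nB))) :=
  {z | z.fst ∈ G.xStar s ∧ z.snd ∈ G.yStar s}

/-- The set of Nash equilibria `Z* = ∏_s Z*_s`. -/
def zStar : Set (JointSpace nS nA nB) := {z | ∀ s, z s ∈ G.zStarAt s}

/-- The equilibrium set is never empty, so distances to it are meaningful. -/
theorem zStar_nonempty [NeZero nA] [NeZero nB] : G.zStar.Nonempty := by
  have h1 := fun s => (simplex_isCompact nA).exists_isMinOn (simplex_nonempty nA)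
    (continuous_maxOver (G.qStar s)).continuousOn
  have h2 := fun s => (simplex_isCompact nB).exists_isMaxOn (simplex_nonempty nB)
    (continuous_minOver (G.qStar s)).continuousOn
  choose u hu using h1
  choose w hw using h2
  exact ⟨WithLp.toLp 2 fun s => pairVec (u s) (w s), fun s => ⟨hu s, hw s⟩⟩

/-- `c` is an error-bound constant of the game: for all policy pairs and all states,
`max_{y'} ⟨x_s, Q*_s y'⟩ - min_{x'} ⟨x', Q*_s y_s⟩ ≥ c · dist(z_s, Z*_s)`. -/
def IsErrorBound (c : ℝ) : Prop :=
  ∀ (x : Policy nS nA) (y : Policy nS nB) (s : Fin nS),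
    c * Metric.infDist (pairVec (x s : EuclideanSpace ℝ (Fin nA)) (y s)) (G.zStarAt s) ≤
      maxOver (G.qStar s) (x s) - minOver (G.qStar s) (y s)

/-- `H = (1 + γ)/(1 - γ)`. -/
def horizon : ℝ := (1 + G.γ) / (1 - G.γ)

/-- `Q_s[V] y_s`. -/
def qLo (V : Fin nS → ℝ) (y : Policy nS nB) (s : Fin nS) : EuclideanSpace ℝ (Fin nA) :=
  WithLp.toLp 2 (fun a => ∑ b, G.bellman V s a b * (y s : EuclideanSpace ℝ (Fin nB)) b)

/-- `Q_s[V]ᵀ x_s`. -/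
def qHi (V : Fin nS → ℝ) (x : Policy nS nA) (s : Fin nS) : EuclideanSpace ℝ (Fin nB) :=
  WithLp.toLp 2 (fun b => ∑ a, G.bellman V s a b * (x s : EuclideanSpace ℝ (Fin nA)) a)

/-- Averaging OGDA started from `(xin, yin)` with stepsize `η`. The argument `n` is the number of
updates made: for a run on `[T₁ : T₂]`, the variables at iteration `t` are those with
`n = t - T₁`. -/
def aogda [NeZero nA] [NeZero nB] (η : ℝ) (xin : Policy nS nA) (yin : Policy nS nB) :
    ℕ → AOGDAState nS nA nB
  | 0 =>
    { x := xin
      y := yin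
      xt := xin
      yt := yin
      Vlo := G.valueMin yin
      Vhi := G.valueMax xin }
  | n + 1 =>
    let prev := aogda η xin yin n
    let Vlo : Fin nS → ℝ := fun s => ⨅ a : Fin nA, ∑ j : Fin (n + 1),
      alphaWeight G.horizon (j.1 + 1) (n + 1) *
        G.qLo (aogda η xin yin j.1).Vlo (aogda η xin yin j.1).y s a
    let Vhi : Fin nS → ℝ := fun s => ⨆ b : Fin nB, ∑ j : Fin (n + 1),
      alphaWeight G.horizon (j.1 + 1) (n + 1) *
        G.qHi (aogda η xin yin j.1).Vhi (aogda η xin yin j.1).x s b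
    let x : Policy nS nA := fun s =>
      projSimplex ((prev.xt s : EuclideanSpace ℝ (Fin nA)) - η • G.qLo prev.Vlo prev.y s)
    let y : Policy nS nB := fun s =>
      projSimplex ((prev.yt s : EuclideanSpace ℝ (Fin nB)) + η • G.qHi prev.Vhi prev.x s)
    { x := x
      y := y
      xt := fun s =>
        projSimplex ((prev.xt s : EuclideanSpace ℝ (Fin nA)) - η • G.qLo Vlo y s)
      yt := fun s =>
        projSimplex ((prev.yt s : EuclideanSpace ℝ (Fin nB)) + η • G.qHi Vhi x s)
      Vlo := Vlo
      Vhi := Vhi }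
termination_by n => n
decreasing_by all_goals omega

/-- The average policy pair `ẑ^{[T₁:T₂]}` of Averaging OGDA on `[T₁ : T₂]`:
`ẑ_s = ∑_{t=T₁}^{T₂} α_{T₂-T₁+1}^{t-T₁+1} (x^t_s, y^t_s)`. -/
def avgPolicy [NeZero nA] [NeZero nB] (η : ℝ) (xin : Policy nS nA) (yin : Policy nS nB)
    (T₁ T₂ : ℕ) : JointSpace nS nA nB :=
  WithLp.toLp 2 fun s => ∑ t ∈ Finset.Icc T₁ T₂,
    alphaWeight G.horizon (t - T₁ + 1) (T₂ - T₁ + 1) •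
      pairVec ((G.aogda η xin yin (t - T₁)).x s : EuclideanSpace ℝ (Fin nA))
        ((G.aogda η xin yin (t - T₁)).y s)

end MarkovGame

end

/-! The lower and upper estimates bracket the minimax value, `Vlo ≤ v* ≤ Vhi`, and their difference
bounds the duality gap of the averaged policies in every matrix game `Q*_s`. The reason is that the
estimates average the payoffs `Q[Vhi]ᵀ x` and `Q[Vlo] y` with the very weights that average the
policies, and the Bellman operator is monotone (`maxOver_avgX_le`, `le_minOver_avgY`, `gap_avg_le`).
The bracket itself is propagated by Shapley's equation `v*(s) = upperValue Q*_s`. Hence it suffices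
to bound the largest gap `Γ_t` of the estimates and to divide by the error-bound constant.

The estimate at step `t+1` compares the averaged payoffs of one fixed pair of pure actions.
Replacing these actions by the current policies costs the weighted regret of both players; what
remains is a difference of Bellman payoffs, at most `γ Γ_j` at time `j`. Thus `Γ_{t+1} ≤ γ · avg(Γ)
+ avg(regret)` (`exists_valueGap_succ_le`).

Each optimistic step makes the regret telescope: the squared change of the payoff vector is paid for
by the negative squared distances in `optimistic_step` and by the drift of the value estimates,
which is of order `α_t` and therefore square summable (`regret_succ_le`). Since the weights increase
with time, summation by parts gives an averaged regret of order `1/(η(H+t))`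
(`wavg_le_of_potential`). The recursion for `Γ` is then solved by `(H+1)ρ/(H+t)`, because
`(H+1)(1-γ) = 2` leaves a contraction strong enough to preserve this rate (`wavg_le_of_recursion`).
The resulting rate is `1/t`, with no logarithm and only `(1-γ)^{-3}`; the stated bound is weaker.

An error-bound constant exists because minimizing `max_w ⟨u, M w⟩` is a linear program on a compact
polyhedron, and linear programs have sharp minima (`exists_sharp_minimum_polyhedron`). Weak duality
is enough to combine the two players. -/

noncomputable section

/-! ### Expectations under finite laws and averages over the simplex -/

theorem pmf_integral_bind {α β : Type*} [Fintype α] [Fintype β] (p : PMF α) (g : α → PMF β)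
    (f : β → ℝ) :
    ∑ b, ((p.bind g) b).toReal * f b = ∑ a, (p a).toReal * ∑ b, (g a b).toReal * f b := by
  have h : ∀ b, ((p.bind g) b).toReal = ∑ a, (p a).toReal * (g a b).toReal := by
    intro b
    rw [PMF.bind_apply, tsum_fintype, ENNReal.toReal_sum]
    · simp [ENNReal.toReal_mul]
    · intro a _
      exact ENNReal.mul_ne_top (PMF.apply_ne_top _ _) (PMF.apply_ne_top _ _)
  simp only [h, Finset.sum_mul, Finset.mul_sum]
  rw [Finset.sum_comm]
  simp only [mul_assoc]

theorem simplexPMF_toReal {n : ℕ} (x : simplex n) (i : Fin n) :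
    (simplexPMF x i).toReal = (x : EuclideanSpace ℝ (Fin n)) i := by
  rw [simplexPMF, PMF.ofFintype_apply, ENNReal.toReal_ofReal (x.2.1 i)]

theorem simplex_coord_nonneg {n : ℕ} (x : simplex n) (i : Fin n) :
    0 ≤ (x : EuclideanSpace ℝ (Fin n)) i := x.2.1 i

theorem simplex_coord_sum {n : ℕ} (x : simplex n) :
    ∑ i, (x : EuclideanSpace ℝ (Fin n)) i = 1 := x.2.2

theorem simplex_avg_le {n : ℕ} (x : simplex n) {f : Fin n → ℝ} {c : ℝ} (h : ∀ i, f i ≤ c) :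
    ∑ i, (x : EuclideanSpace ℝ (Fin n)) i * f i ≤ c := by
  calc _ ≤ ∑ i, (x : EuclideanSpace ℝ (Fin n)) i * c :=
        Finset.sum_le_sum fun i _ => mul_le_mul_of_nonneg_left (h i) (simplex_coord_nonneg x i)
    _ = c := by rw [← Finset.sum_mul, simplex_coord_sum, one_mul]

theorem le_simplex_avg {n : ℕ} (x : simplex n) {f : Fin n → ℝ} {c : ℝ} (h : ∀ i, c ≤ f i) :
    c ≤ ∑ i, (x : EuclideanSpace ℝ (Fin n)) i * f i := by
  calc c = ∑ i, (x : EuclideanSpace ℝ (Fin n)) i * c := by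
        rw [← Finset.sum_mul, simplex_coord_sum, one_mul]
    _ ≤ _ := Finset.sum_le_sum fun i _ => mul_le_mul_of_nonneg_left (h i) (simplex_coord_nonneg x i)

/-! ### Bilinear payoffs and the upper value of a matrix game -/

theorem bilin_eq_left {nA nB : ℕ} (M : Matrix (Fin nA) (Fin nB) ℝ)
    (u : EuclideanSpace ℝ (Fin nA)) (w : EuclideanSpace ℝ (Fin nB)) :
    bilin M u w = ∑ a, u a * ∑ b, w b * M a b := by
  unfold bilin
  refine Finset.sum_congr rfl fun a _ => ?_
  rw [Finset.mul_sum]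
  exact Finset.sum_congr rfl fun b _ => by ring

theorem bilin_eq_right {nA nB : ℕ} (M : Matrix (Fin nA) (Fin nB) ℝ)
    (u : EuclideanSpace ℝ (Fin nA)) (w : EuclideanSpace ℝ (Fin nB)) :
    bilin M u w = ∑ b, w b * ∑ a, u a * M a b := by
  unfold bilin
  rw [Finset.sum_comm]
  refine Finset.sum_congr rfl fun a _ => ?_
  rw [Finset.mul_sum]
  exact Finset.sum_congr rfl fun b _ => by ring

theorem bilin_le_add {nA nB : ℕ} {M N : Matrix (Fin nA) (Fin nB) ℝ} {d : ℝ}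
    (h : ∀ a b, M a b ≤ N a b + d) (u : simplex nA) (w : simplex nB) :
    bilin M u w ≤ bilin N u w + d := by
  have : bilin M u w - bilin N u w ≤ d := by
    rw [bilin_eq_left, bilin_eq_left, ← Finset.sum_sub_distrib]
    simp only [← mul_sub, ← Finset.sum_sub_distrib]
    exact simplex_avg_le u fun a => simplex_avg_le w fun b => by linarith [h a b]
  linarith

theorem bddAbove_bilin_right {nA nB : ℕ} (M : Matrix (Fin nA) (Fin nB) ℝ)
    (u : EuclideanSpace ℝ (Fin nA)) :
    BddAbove (Set.range fun w : simplex nB => bilin M u w) := by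
  have := ((simplex_isCompact nB).image (f := fun w => bilin M u w)
    ((continuous_bilin M).comp (by fun_prop : Continuous fun w => (u, w)))).bddAbove
  rwa [Set.image_eq_range] at this

theorem bddBelow_bilin_left {nA nB : ℕ} (M : Matrix (Fin nA) (Fin nB) ℝ)
    (w : EuclideanSpace ℝ (Fin nB)) :
    BddBelow (Set.range fun u : simplex nA => bilin M u w) := by
  have := ((simplex_isCompact nA).image (f := fun u => bilin M u w)
    ((continuous_bilin M).comp (by fun_prop : Continuous fun u => (u, w)))).bddBelow
  rwa [Set.image_eq_range] at this

theorem bilin_le_maxOver {nA nB : ℕ} (M : Matrix (Fin nA) (Fin nB) ℝ)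
    (u : EuclideanSpace ℝ (Fin nA)) (w : simplex nB) : bilin M u w ≤ maxOver M u :=
  le_ciSup (bddAbove_bilin_right M u) w

theorem minOver_le_bilin {nA nB : ℕ} (M : Matrix (Fin nA) (Fin nB) ℝ)
    (u : simplex nA) (w : EuclideanSpace ℝ (Fin nB)) : minOver M w ≤ bilin M u w :=
  ciInf_le (bddBelow_bilin_left M w) u

instance simplex_nonempty_inst (n : ℕ) [NeZero n] : Nonempty (simplex n) :=
  (simplex_nonempty n).to_subtype

theorem exists_bilin_eq_maxOver {nA nB : ℕ} [NeZero nB] (M : Matrix (Fin nA) (Fin nB) ℝ)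
    (u : EuclideanSpace ℝ (Fin nA)) : ∃ w : simplex nB, bilin M u w = maxOver M u := by
  obtain ⟨w, hw, h⟩ := (simplex_isCompact nB).exists_isMaxOn (simplex_nonempty nB)
    (f := fun w => bilin M u w)
    ((continuous_bilin M).comp (by fun_prop : Continuous fun w => (u, w))).continuousOn
  exact ⟨⟨w, hw⟩, le_antisymm (bilin_le_maxOver M u ⟨w, hw⟩) (ciSup_le fun v => h v.2)⟩

theorem exists_bilin_eq_minOver {nA nB : ℕ} [NeZero nA] (M : Matrix (Fin nA) (Fin nB) ℝ)
    (w : EuclideanSpace ℝ (Fin nB)) : ∃ u : simplex nA, bilin M u w = minOver M w := by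
  obtain ⟨u, hu, h⟩ := (simplex_isCompact nA).exists_isMinOn (simplex_nonempty nA)
    (f := fun u => bilin M u w)
    ((continuous_bilin M).comp (by fun_prop : Continuous fun u => (u, w))).continuousOn
  exact ⟨⟨u, hu⟩, le_antisymm (le_ciInf fun v => h v.2) (minOver_le_bilin M ⟨u, hu⟩ w)⟩

/-- The upper value `min_u max_w ⟨u, M w⟩` of a matrix game. -/
def upperValue {nA nB : ℕ} (M : Matrix (Fin nA) (Fin nB) ℝ) : ℝ :=
  ⨅ u : simplex nA, maxOver M u

theorem exists_maxOver_eq_upperValue {nA nB : ℕ} [NeZero nA] (M : Matrix (Fin nA) (Fin nB) ℝ) :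
    ∃ u : simplex nA, maxOver M u = upperValue M ∧ ∀ v : simplex nA, maxOver M u ≤ maxOver M v := by
  obtain ⟨u, hu, h⟩ := (simplex_isCompact nA).exists_isMinOn (simplex_nonempty nA)
    (continuous_maxOver M).continuousOn
  have h' : ∀ v : simplex nA, maxOver M u ≤ maxOver M v := fun v => h v.2
  refine ⟨⟨u, hu⟩, le_antisymm (le_ciInf h') (ciInf_le ⟨maxOver M u, ?_⟩ (⟨u, hu⟩ : simplex nA)),
    h'⟩
  rintro _ ⟨v, rfl⟩
  exact h' v

theorem upperValue_le_maxOver {nA nB : ℕ} [NeZero nA] (M : Matrix (Fin nA) (Fin nB) ℝ)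
    (u : simplex nA) : upperValue M ≤ maxOver M u := by
  obtain ⟨v, hv, h⟩ := exists_maxOver_eq_upperValue M
  exact hv ▸ h u

theorem minOver_le_upperValue {nA nB : ℕ} [NeZero nA] (M : Matrix (Fin nA) (Fin nB) ℝ)
    (w : simplex nB) : minOver M w ≤ upperValue M :=
  le_ciInf fun u => (minOver_le_bilin M u w).trans (bilin_le_maxOver M u w)

theorem upperValue_le_add {nA nB : ℕ} [NeZero nA] [NeZero nB] {M N : Matrix (Fin nA) (Fin nB) ℝ}
    {d : ℝ} (h : ∀ a b, M a b ≤ N a b + d) : upperValue M ≤ upperValue N + d := by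
  obtain ⟨u, hu, -⟩ := exists_maxOver_eq_upperValue N
  obtain ⟨w, hw⟩ := exists_bilin_eq_maxOver M u
  calc upperValue M ≤ maxOver M u := upperValue_le_maxOver M u
    _ = bilin M u w := hw.symm
    _ ≤ bilin N u w + d := bilin_le_add h u w
    _ ≤ _ := by rw [← hu]; linarith [bilin_le_maxOver N u w]

/-! ### Trajectory expectations, the Bellman equation and Shapley's theorem -/

namespace MarkovGame

variable {nS nA nB : ℕ} (G : MarkovGame nS nA nB)

theorem roundPMF_integral (x : Policy nS nA) (y : Policy nS nB) (s : Fin nS)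
    (f : Fin nS × Fin nA × Fin nB → ℝ) :
    ∑ r, (roundPMF x y s r).toReal * f r = bilin (Matrix.of fun a b => f (s, a, b)) (x s) (y s) := by
  rw [roundPMF, pmf_integral_bind, bilin_eq_left]
  refine Finset.sum_congr rfl fun a _ => ?_
  rw [pmf_integral_bind, simplexPMF_toReal]
  congr 1
  refine Finset.sum_congr rfl fun b _ => ?_
  rw [simplexPMF_toReal]
  congr 1
  rw [Finset.sum_eq_single (s, a, b)]
  · simp
  · intro r _ hr
    simp [hr]
  · simp

/-- Expectation of `f` at the next round, given the current one. -/
def nextExp (x : Policy nS nA) (y : Policy nS nB) (f : Fin nS × Fin nA × Fin nB → ℝ)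
    (r : Fin nS × Fin nA × Fin nB) : ℝ :=
  ∑ s', (G.P r.1 r.2.1 r.2.2 : EuclideanSpace ℝ (Fin nS)) s' *
    bilin (Matrix.of fun a b => f (s', a, b)) (x s') (y s')

theorem nextPMF_integral (x : Policy nS nA) (y : Policy nS nB) (r : Fin nS × Fin nA × Fin nB)
    (f : Fin nS × Fin nA × Fin nB → ℝ) :
    ∑ r', (G.nextPMF x y r r').toReal * f r' = G.nextExp x y f r := by
  rw [nextPMF, pmf_integral_bind, nextExp]
  simp only [simplexPMF_toReal, roundPMF_integral]

instance (x : Policy nS nA) (y : Policy nS nB) (s : Fin nS) :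
    IsProbabilityMeasure (G.trajLaw x y s) := by
  unfold trajLaw
  have : IsProbabilityMeasure (roundPMF x y s).toMeasure := PMF.toMeasure.isProbabilityMeasure _
  infer_instance

theorem integrable_of_round (x : Policy nS nA) (y : Policy nS nB) (s : Fin nS) (t : ℕ)
    (f : Fin nS × Fin nA × Fin nB → ℝ) :
    Integrable (fun ω : ℕ → Fin nS × Fin nA × Fin nB => f (ω t)) (G.trajLaw x y s) := by
  have hm : Measurable fun ω : ℕ → Fin nS × Fin nA × Fin nB => f (ω t) :=
    (measurable_of_finite f).comp (measurable_pi_apply t)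
  refine Integrable.of_bound hm.aestronglyMeasurable (∑ r, |f r|) (ae_of_all _ fun ω => ?_)
  exact Finset.single_le_sum (f := fun r => |f r|) (fun _ _ => abs_nonneg _) (Finset.mem_univ (ω t))

theorem integral_round_zero (x : Policy nS nA) (y : Policy nS nB) (s : Fin nS)
    (f : Fin nS × Fin nA × Fin nB → ℝ) :
    ∫ ω, f (ω 0) ∂(G.trajLaw x y s) =
      bilin (Matrix.of fun a b => f (s, a, b)) (x s) (y s) := by
  have : IsProbabilityMeasure (roundPMF x y s).toMeasure := PMF.toMeasure.isProbabilityMeasure _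
  have hmap : (G.trajLaw x y s).map (fun ω => ω 0) = (roundPMF x y s).toMeasure := by
    -- Evaluation at time 0 factors through the history up to time 0, on which the trajectory kernel
    -- acts as the identity.
    have h0 : (fun ω : ℕ → Fin nS × Fin nA × Fin nB => ω 0) =
        (MeasurableEquiv.piUnique fun _ : Finset.Iic (0 : ℕ) => Fin nS × Fin nA × Fin nB) ∘
          (Preorder.frestrictLe (π := fun _ : ℕ => Fin nS × Fin nA × Fin nB) 0) := by
      rfl
    rw [h0, ← Measure.map_map (by fun_prop) (by fun_prop), trajLaw, Kernel.trajMeasure,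
      Measure.map_comp _ _ (by fun_prop), Kernel.traj_map_frestrictLe, Kernel.partialTraj_self,
      Measure.id_comp, Measure.map_map (by fun_prop) (by fun_prop)]
    convert Measure.map_id
    ext r : 1
    simp
  rw [← integral_map (φ := fun ω : ℕ → Fin nS × Fin nA × Fin nB => ω 0) (f := f)
    (measurable_pi_apply 0).aemeasurable (measurable_of_finite f).aestronglyMeasurable, hmap,
    PMF.integral_eq_sum]
  exact roundPMF_integral x y s f

theorem integral_round_succ (x : Policy nS nA) (y : Policy nS nB) (s : Fin nS) (t : ℕ)
    (f : Fin nS × Fin nA × Fin nB → ℝ) :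
    ∫ ω, f (ω (t + 1)) ∂(G.trajLaw x y s) = ∫ ω, G.nextExp x y f (ω t) ∂(G.trajLaw x y s) := by
  have : IsProbabilityMeasure (roundPMF x y s).toMeasure := PMF.toMeasure.isProbabilityMeasure _
  have key := Kernel.map_frestrictLe_trajMeasure_compProd_eq_map_trajMeasure
    (X := fun _ : ℕ => Fin nS × Fin nA × Fin nB) (κ := G.stepKernel x y)
    (μ₀ := (roundPMF x y s).toMeasure) (a := t)
  have hmeas : Measurable (fun ω : ℕ → Fin nS × Fin nA × Fin nB =>
      (Preorder.frestrictLe (π := fun _ : ℕ => Fin nS × Fin nA × Fin nB) t ω, ω (t + 1))) := by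
    fun_prop
  have hf : Measurable f := measurable_of_finite f
  have hsnd : Measurable (fun p : ((i : Finset.Iic t) → (fun _ : ℕ => Fin nS × Fin nA × Fin nB) i) ×
      (Fin nS × Fin nA × Fin nB) => f p.2) := hf.comp measurable_snd
  have h1 : ∫ ω, f (ω (t + 1)) ∂(G.trajLaw x y s) =
      ∫ p, f p.2 ∂((G.trajLaw x y s).map fun ω =>
        (Preorder.frestrictLe (π := fun _ : ℕ => Fin nS × Fin nA × Fin nB) t ω, ω (t + 1))) := by
    rw [integral_map hmeas.aemeasurable hsnd.aestronglyMeasurable]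
  have : IsProbabilityMeasure ((G.trajLaw x y s).map
      (Preorder.frestrictLe (π := fun _ : ℕ => Fin nS × Fin nA × Fin nB) t)) :=
    Measure.isProbabilityMeasure_map (by fun_prop)
  rw [h1]
  unfold trajLaw at *
  rw [← key, Measure.integral_compProd]
  · have h2 : ∀ h, ∫ r, f r ∂(G.stepKernel x y t h) =
        G.nextExp x y f (h ⟨t, Finset.mem_Iic.2 le_rfl⟩) := by
      intro h
      rw [← nextPMF_integral]
      exact PMF.integral_eq_sum _ _
    simp only [h2]
    rw [integral_map (by fun_prop)]
    · rfl
    · exact ((measurable_of_finite (G.nextExp x y f)).comp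
        (measurable_pi_apply _)).aestronglyMeasurable
  · refine Integrable.of_bound hsnd.aestronglyMeasurable (∑ r, |f r|) (ae_of_all _ fun p => ?_)
    exact Finset.single_le_sum (f := fun r => |f r|) (fun _ _ => abs_nonneg _)
      (Finset.mem_univ p.2)

/-- The reward as a function of the round. -/
def roundReward (r : Fin nS × Fin nA × Fin nB) : ℝ := G.R r.1 r.2.1 r.2.2

theorem integral_round (x : Policy nS nA) (y : Policy nS nB) (s : Fin nS) (t : ℕ)
    (f : Fin nS × Fin nA × Fin nB → ℝ) :
    ∫ ω, f (ω t) ∂(G.trajLaw x y s) =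
      bilin (Matrix.of fun a b => (G.nextExp x y)^[t] f (s, a, b)) (x s) (y s) := by
  induction t generalizing f with
  | zero => exact G.integral_round_zero x y s f
  | succ t ih => rw [integral_round_succ, ih, Function.iterate_succ_apply]

theorem bilin_nonneg {M : Matrix (Fin nA) (Fin nB) ℝ} (h : ∀ a b, 0 ≤ M a b)
    (u : simplex nA) (w : simplex nB) : 0 ≤ bilin M u w := by
  rw [bilin_eq_left]
  exact le_simplex_avg u fun a => le_simplex_avg w fun b => h a b

theorem bilin_le_of_le {M : Matrix (Fin nA) (Fin nB) ℝ} {c : ℝ} (h : ∀ a b, M a b ≤ c)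
    (u : simplex nA) (w : simplex nB) : bilin M u w ≤ c := by
  rw [bilin_eq_left]
  exact simplex_avg_le u fun a => simplex_avg_le w fun b => h a b

/-- The terms are dominated by `γ^t`, so expectation and discounted sum may be exchanged; the Markov
property turns the expectation at time `t` into `t` applications of the one-step operator. -/
theorem hasSum_value (x : Policy nS nA) (y : Policy nS nB) (s : Fin nS) :
    HasSum (fun t => G.γ ^ t * bilin (Matrix.of fun a b =>
      (G.nextExp x y)^[t] G.roundReward (s, a, b)) (x s) (y s)) (G.value x y s) := by
  have hb : ∀ t (ω : ℕ → Fin nS × Fin nA × Fin nB),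
      ‖G.γ ^ t * G.roundReward (ω t)‖ ≤ G.γ ^ t := by
    intro t ω
    have h0 : 0 ≤ G.roundReward (ω t) := G.R_nonneg _ _ _
    have h1 : G.roundReward (ω t) ≤ 1 := G.R_le_one _ _ _
    have h2 := pow_nonneg G.γ_nonneg t
    rw [Real.norm_of_nonneg (by positivity)]
    nlinarith
  have h := hasSum_integral_of_dominated_convergence (μ := G.trajLaw x y s)
    (F := fun t ω => G.γ ^ t * G.roundReward (ω t))
    (f := fun ω => ∑' t : ℕ, G.γ ^ t * G.R (ω t).1 (ω t).2.1 (ω t).2.2)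
    (bound := fun t _ => G.γ ^ t)
    (fun t => ((G.integrable_of_round x y s t G.roundReward).const_mul _).aestronglyMeasurable)
    (fun t => ae_of_all _ (hb t))
    (ae_of_all _ fun _ => summable_geometric_of_lt_one G.γ_nonneg G.γ_lt_one)
    (integrable_const _)
    (ae_of_all _ fun ω => (Summable.of_norm_bounded
      (summable_geometric_of_lt_one G.γ_nonneg G.γ_lt_one) fun t => hb t ω).hasSum)
  simp only [integral_const_mul, integral_round] at h
  exact h

theorem bilin_add {M N : Matrix (Fin nA) (Fin nB) ℝ} (u : EuclideanSpace ℝ (Fin nA))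
    (w : EuclideanSpace ℝ (Fin nB)) : bilin (M + N) u w = bilin M u w + bilin N u w := by
  simp only [bilin, Matrix.add_apply, mul_add, add_mul, Finset.sum_add_distrib]

/-- Splitting off the reward of time 0 leaves the series of the values at the next state, multiplied
by `γ` and averaged over the transition. -/
theorem value_eq_bilin (x : Policy nS nA) (y : Policy nS nB) (s : Fin nS) :
    G.value x y s = bilin (G.bellman (G.value x y) s) (x s) (y s) := by
  have h := G.hasSum_value x y s
  rw [← hasSum_nat_add_iff' 1] at h
  have h2 : HasSum (fun t => G.γ ^ (t + 1) * bilin (Matrix.of fun a b =>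
      (G.nextExp x y)^[t + 1] G.roundReward (s, a, b)) (x s) (y s))
      (bilin (Matrix.of fun a b => G.γ * ∑ s', (G.P s a b : EuclideanSpace ℝ (Fin nS)) s' *
        G.value x y s') (x s) (y s)) := by
    have h3 : ∀ a b, HasSum (fun t => G.γ ^ (t + 1) *
        (G.nextExp x y)^[t + 1] G.roundReward (s, a, b))
        (G.γ * ∑ s', (G.P s a b : EuclideanSpace ℝ (Fin nS)) s' * G.value x y s') := by
      intro a b
      have := (hasSum_sum (s := Finset.univ) fun s' _ => (G.hasSum_value x y s').mul_left
        ((G.P s a b : EuclideanSpace ℝ (Fin nS)) s')).mul_left G.γ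
      refine (congrArg (fun g => HasSum g _) (funext fun t => ?_)).mpr this
      rw [Function.iterate_succ_apply', nextExp, Finset.mul_sum, Finset.mul_sum]
      exact Finset.sum_congr rfl fun s' _ => by ring
    have := hasSum_sum (s := Finset.univ) fun a _ => hasSum_sum (s := Finset.univ) fun b _ =>
      ((h3 a b).mul_left ((x s : EuclideanSpace ℝ (Fin nA)) a)).mul_right
        ((y s : EuclideanSpace ℝ (Fin nB)) b)
    refine (congrArg (fun g => HasSum g _) (funext fun t => ?_)).mpr this
    rw [bilin, Finset.mul_sum]
    refine Finset.sum_congr rfl fun a _ => ?_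
    rw [Finset.mul_sum]
    exact Finset.sum_congr rfl fun b _ => by simp only [Matrix.of_apply]; ring
  have h4 := h.unique h2
  have h5 : G.bellman (G.value x y) s = (Matrix.of fun a b => G.roundReward (s, a, b)) +
      Matrix.of fun a b => G.γ * ∑ s', (G.P s a b : EuclideanSpace ℝ (Fin nS)) s' *
        G.value x y s' := rfl
  rw [h5, bilin_add, ← h4]
  simp

theorem bellman_le_add {v v' : Fin nS → ℝ} {d : ℝ} (h : ∀ s, v s ≤ v' s + d) (s : Fin nS)
    (a : Fin nA) (b : Fin nB) : G.bellman v s a b ≤ G.bellman v' s a b + G.γ * d := by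
  have : ∑ s', (G.P s a b : EuclideanSpace ℝ (Fin nS)) s' * v s' ≤
      ∑ s', (G.P s a b : EuclideanSpace ℝ (Fin nS)) s' * v' s' + d := by
    have := simplex_avg_le (G.P s a b) (f := fun s' => v s' - v' s') (c := d)
      fun s' => by linarith [h s']
    simp only [mul_sub, Finset.sum_sub_distrib] at this
    linarith
  simp only [bellman, Matrix.of_apply]
  nlinarith [G.γ_nonneg]

/-- One-sided contraction principle: with `d` equal to the largest excess of `v` over `w`, the
hypothesis gives `d ≤ γ d`, so `d ≤ 0`. -/
theorem le_of_le_gap [NeZero nS] {v w : Fin nS → ℝ}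
    (h : ∀ d, (∀ s, v s ≤ w s + d) → ∀ s, v s ≤ w s + G.γ * d) (s : Fin nS) : v s ≤ w s := by
  obtain ⟨s₀, hs₀⟩ := Finite.exists_max fun s => v s - w s
  have h1 := h (v s₀ - w s₀) (fun s => by linarith [hs₀ s]) s₀
  have h2 : v s₀ - w s₀ ≤ 0 := by nlinarith [G.γ_lt_one]
  linarith [hs₀ s]

theorem value_le_of_bilin_le [NeZero nS] (x : Policy nS nA) (y : Policy nS nB) {w : Fin nS → ℝ}
    (h : ∀ s, bilin (G.bellman w s) (x s) (y s) ≤ w s) (s : Fin nS) : G.value x y s ≤ w s := by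
  refine G.le_of_le_gap (fun d hd s => ?_) s
  rw [value_eq_bilin]
  linarith [h s, bilin_le_add (G.bellman_le_add hd s) (x s) (y s)]

theorem le_value_of_le_bilin [NeZero nS] (x : Policy nS nA) (y : Policy nS nB) {w : Fin nS → ℝ}
    (h : ∀ s, w s ≤ bilin (G.bellman w s) (x s) (y s)) (s : Fin nS) : w s ≤ G.value x y s := by
  refine G.le_of_le_gap (fun d hd s => ?_) s
  rw [value_eq_bilin]
  linarith [h s, bilin_le_add (G.bellman_le_add hd s) (x s) (y s)]

theorem one_sub_gamma_pos : 0 < 1 - G.γ := by linarith [G.γ_lt_one]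

theorem bellman_le {v : Fin nS → ℝ} (h : ∀ s, v s ≤ 1 / (1 - G.γ)) (s : Fin nS)
    (a : Fin nA) (b : Fin nB) : G.bellman v s a b ≤ 1 / (1 - G.γ) := by
  have h1 := simplex_avg_le (G.P s a b) h
  have h2 := G.R_le_one s a b
  have h3 := mul_le_mul_of_nonneg_left h1 G.γ_nonneg
  have h4 : 1 + G.γ * (1 / (1 - G.γ)) = 1 / (1 - G.γ) := by
    have := G.one_sub_gamma_pos.ne'
    field_simp
    ring
  simp only [bellman, Matrix.of_apply]
  linarith

theorem bellman_nonneg {v : Fin nS → ℝ} (h : ∀ s, 0 ≤ v s) (s : Fin nS)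
    (a : Fin nA) (b : Fin nB) : 0 ≤ G.bellman v s a b := by
  have h1 := le_simplex_avg (G.P s a b) h
  have h2 := G.R_nonneg s a b
  have h3 := mul_nonneg G.γ_nonneg h1
  simp only [bellman, Matrix.of_apply]
  linarith

theorem value_nonneg [NeZero nS] (x : Policy nS nA) (y : Policy nS nB) (s : Fin nS) :
    0 ≤ G.value x y s :=
  G.le_value_of_le_bilin x y (w := fun _ => 0)
    (fun s => bilin_nonneg (fun a b => G.bellman_nonneg (fun _ => le_rfl) s a b) _ _) s

theorem value_le [NeZero nS] (x : Policy nS nA) (y : Policy nS nB) (s : Fin nS) :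
    G.value x y s ≤ 1 / (1 - G.γ) :=
  G.value_le_of_bilin_le x y (w := fun _ => 1 / (1 - G.γ))
    (fun s => bilin_le_of_le (fun a b => G.bellman_le (fun _ => le_rfl) s a b) _ _) s

theorem value_le_valueMax [NeZero nS] (x : Policy nS nA) (y : Policy nS nB) (s : Fin nS) :
    G.value x y s ≤ G.valueMax x s :=
  le_ciSup (f := fun y => G.value x y s)
    ⟨1 / (1 - G.γ), by rintro _ ⟨y, rfl⟩; exact G.value_le x y s⟩ y

theorem valueMin_le_value [NeZero nS] (x : Policy nS nA) (y : Policy nS nB) (s : Fin nS) :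
    G.valueMin y s ≤ G.value x y s :=
  ciInf_le (f := fun x => G.value x y s)
    ⟨0, by rintro _ ⟨x, rfl⟩; exact G.value_nonneg x y s⟩ x

theorem valueMax_le [NeZero nS] [NeZero nB] (x : Policy nS nA) (s : Fin nS) :
    G.valueMax x s ≤ 1 / (1 - G.γ) :=
  ciSup_le fun y => G.value_le x y s

theorem valueMax_nonneg [NeZero nS] [NeZero nB] (x : Policy nS nA) (s : Fin nS) :
    0 ≤ G.valueMax x s :=
  (G.value_nonneg x (Classical.arbitrary (Policy nS nB)) s).trans (G.value_le_valueMax x _ s)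

theorem valueMin_nonneg [NeZero nS] [NeZero nA] (y : Policy nS nB) (s : Fin nS) :
    0 ≤ G.valueMin y s :=
  le_ciInf fun x => G.value_nonneg x y s

theorem valueMin_le [NeZero nS] [NeZero nA] (y : Policy nS nB) (s : Fin nS) :
    G.valueMin y s ≤ 1 / (1 - G.γ) :=
  (G.valueMin_le_value (Classical.arbitrary (Policy nS nA)) y s).trans (G.value_le _ y s)

theorem gameValue_le_valueMax [NeZero nS] [NeZero nB] (x : Policy nS nA) (s : Fin nS) :
    G.gameValue s ≤ G.valueMax x s :=
  ciInf_le (f := fun x => G.valueMax x s)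
    ⟨0, by rintro _ ⟨x, rfl⟩; exact G.valueMax_nonneg x s⟩ x

theorem valueMin_le_gameValue [NeZero nS] [NeZero nA] (y : Policy nS nB) (s : Fin nS) :
    G.valueMin y s ≤ G.gameValue s :=
  le_ciInf fun x => (G.valueMin_le_value x y s).trans (G.value_le_valueMax x y s)

theorem exists_shapley_fixedPoint [NeZero nA] [NeZero nB] :
    ∃ w : Fin nS → ℝ, ∀ s, upperValue (G.bellman w s) = w s := by
  let T : (Fin nS → ℝ) → Fin nS → ℝ := fun v s => upperValue (G.bellman v s)
  have hT : ContractingWith (⟨G.γ, G.γ_nonneg⟩ : NNReal) T := by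
    refine ⟨NNReal.coe_lt_coe.1 G.γ_lt_one, LipschitzWith.of_dist_le_mul ?_⟩
    intro v v'
    refine (dist_pi_le_iff (mul_nonneg G.γ_nonneg dist_nonneg)).2 fun s => ?_
    have h : ∀ v v' : Fin nS → ℝ, T v s ≤ T v' s + G.γ * dist v v' := by
      intro v v'
      refine upperValue_le_add (G.bellman_le_add (fun s => ?_) s)
      have h1 := dist_le_pi_dist v v' s
      rw [Real.dist_eq] at h1
      linarith [le_abs_self (v s - v' s)]
    rw [Real.dist_eq, abs_le]
    have h1 := h v v'
    have h2 := h v' v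
    rw [dist_comm v' v] at h2
    change -(G.γ * dist v v') ≤ _ ∧ _ ≤ G.γ * dist v v'
    constructor <;> linarith
  exact ⟨hT.fixedPoint, fun s => congrFun hT.fixedPoint_isFixedPt s⟩

/-- Shapley's theorem: the minimax value satisfies the minimax Bellman equation. -/
theorem gameValue_eq_upperValue [NeZero nS] [NeZero nA] [NeZero nB] (s : Fin nS) :
    G.gameValue s = upperValue (G.qStar s) := by
  obtain ⟨w, hw⟩ := G.exists_shapley_fixedPoint
  have h : G.gameValue = w := by
    ext s
    apply le_antisymm
    -- A policy optimal in every matrix game of the fixed point holds each opponent to at most `w`.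
    · choose x hx _ using fun s => exists_maxOver_eq_upperValue (G.bellman w s)
      refine (G.gameValue_le_valueMax x s).trans (ciSup_le fun y => ?_)
      refine G.value_le_of_bilin_le x y (fun s => ?_) s
      exact (bilin_le_maxOver _ _ (y s)).trans ((hx s).trans (hw s)).le
    -- Conversely, the statewise best response to `x` in these matrix games secures at least `w`.
    · refine le_ciInf fun x => ?_
      choose y hy using fun s => exists_bilin_eq_maxOver (G.bellman w s) (x s)
      refine le_trans ?_ (G.value_le_valueMax x y s)
      refine G.le_value_of_le_bilin x y (fun s => ?_) s
      rw [hy, ← hw s]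
      exact upperValue_le_maxOver _ _
  rw [qStar, h, hw]

end MarkovGame

/-! ### Sharp minima of linear programs and the error bound -/

/-- An extreme point is determined by its set of active constraints. If `x` and `y` share theirs,
then `x` can be moved slightly away from `y` without leaving the polyhedron, which puts `x` inside a
segment ending at `y`. -/
theorem finite_extremePoints_polyhedron {E ι : Type*} [AddCommGroup E] [Module ℝ E] [Finite ι]
    (f : ι → E →ₗ[ℝ] ℝ) (b : ι → ℝ) :
    (Set.extremePoints ℝ {x | ∀ i, f i x ≤ b i}).Finite := by
  refine Set.Finite.of_finite_image (f := fun x => {i | f i x = b i}) (Set.toFinite _) ?_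
  intro x hx y hy hxy
  have hact : ∀ i, f i x = b i ↔ f i y = b i := fun i => Set.ext_iff.1 hxy i
  have hev : ∀ᶠ ε in nhdsWithin (0 : ℝ) (Set.Ioi 0), ∀ i, f i x - ε * (f i y - f i x) ≤ b i := by
    refine Filter.eventually_all.2 fun i => ?_
    by_cases h : f i x = b i
    · have h' := (hact i).1 h
      exact Filter.Eventually.of_forall fun ε => by rw [h, h']; simp
    · have hlt : f i x - 0 * (f i y - f i x) < b i := by
        simpa using lt_of_le_of_ne (hx.1 i) h
      have hc : Continuous fun ε : ℝ => f i x - ε * (f i y - f i x) := by fun_prop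
      exact ((hc.tendsto 0).eventually (gt_mem_nhds hlt)).filter_mono nhdsWithin_le_nhds
        |>.mono fun _ h => h.le
  obtain ⟨ε, hε, hpos⟩ := (hev.and self_mem_nhdsWithin).exists
  have hpos : (0 : ℝ) < ε := hpos
  have hz : x - ε • (y - x) ∈ {x | ∀ i, f i x ≤ b i} := fun i => by
    simpa using hε i
  have hseg : x ∈ openSegment ℝ (x - ε • (y - x)) y := by
    refine ⟨1 / (1 + ε), ε / (1 + ε), by positivity, by positivity, by field_simp, ?_⟩
    have h2 : (1 + ε) ≠ 0 := by positivity
    match_scalars <;> field_simp <;> ring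
  exact ((mem_extremePoints.1 hx).2 _ hz _ hy.1 hseg).2.symm

/-- Linear programs over compact polyhedra have sharp minima. -/
theorem exists_sharp_minimum_polyhedron {E ι : Type*} [NormedAddCommGroup E] [NormedSpace ℝ E]
    [Finite ι] (f : ι → E →ₗ[ℝ] ℝ) (b : ι → ℝ) (hP : IsCompact {x | ∀ i, f i x ≤ b i})
    (ℓ : E →ₗ[ℝ] ℝ) {z₀ : E} (hz₀ : ∀ i, f i z₀ ≤ b i)
    (hmin : ∀ x, (∀ i, f i x ≤ b i) → ℓ z₀ ≤ ℓ x) :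
    ∃ c : ℝ, 0 < c ∧ ∀ x, (∀ i, f i x ≤ b i) →
      ∃ z, (∀ i, f i z ≤ b i) ∧ ℓ z = ℓ z₀ ∧ c * ‖x - z‖ ≤ ℓ x - ℓ z₀ := by
  classical
  set P : Set E := {x | ∀ i, f i x ≤ b i} with hPdef
  have hconv : Convex ℝ P := by
    have : P = ⋂ i, {x | f i x ≤ b i} := by ext; simp [hPdef]
    rw [this]
    exact convex_iInter fun i => convex_halfSpace_le (f i).isLinear _
  have hfin : (P.extremePoints ℝ).Finite := finite_extremePoints_polyhedron f b
  have hhull : convexHull ℝ (P.extremePoints ℝ) = P := by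
    rw [← (hfin.isClosed_convexHull ℝ).closure_eq, closure_convexHull_extremePoints hP hconv]
  obtain ⟨F, hF⟩ := hfin.exists_finset_coe
  -- Optimal vertices stay in place and all others are sent to `z₀`. Writing `x` as a convex
  -- combination of vertices and applying `r` to each of them yields the minimizer close to `x`.
  let r : E → E := fun y => if ℓ y = ℓ z₀ then y else z₀
  have hFP : ∀ y ∈ F, y ∈ P := fun y hy => by
    have : y ∈ P.extremePoints ℝ := by rw [← hF]; exact hy
    exact this.1
  -- For a vertex that is not optimal the inequality is strict at `c = 0`; there are finitely many
  -- vertices, so one small positive `c` serves them all.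
  have hev : ∀ᶠ c in nhdsWithin (0 : ℝ) (Set.Ioi 0), ∀ y ∈ F, c * ‖y - r y‖ ≤ ℓ y - ℓ z₀ := by
    refine (Filter.eventually_all_finset F).2 fun y hy => ?_
    by_cases h : ℓ y = ℓ z₀
    · exact Filter.Eventually.of_forall fun c => by simp [r, h]
    · have hlt : 0 * ‖y - r y‖ < ℓ y - ℓ z₀ := by
        have := lt_of_le_of_ne (hmin y (hFP y hy)) (Ne.symm h)
        linarith
      have hc : Continuous fun c : ℝ => c * ‖y - r y‖ := by fun_prop
      exact ((hc.tendsto 0).eventually (gt_mem_nhds hlt)).filter_mono nhdsWithin_le_nhds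
        |>.mono fun _ h => h.le
  obtain ⟨c, hc, hpos⟩ := (hev.and self_mem_nhdsWithin).exists
  refine ⟨c, hpos, fun x hx => ?_⟩
  have hx' : x ∈ convexHull ℝ (F : Set E) := by rw [hF, hhull]; exact hx
  obtain ⟨w, hw0, hw1, hwx⟩ := Finset.mem_convexHull'.1 hx'
  have hr : ∀ y ∈ F, r y ∈ P := fun y hy => by
    by_cases h : ℓ y = ℓ z₀ <;> simp only [r, h, if_true, if_false]
    exacts [hFP y hy, hz₀]
  have hℓr : ∀ y, ℓ (r y) = ℓ z₀ := fun y => by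
    by_cases h : ℓ y = ℓ z₀ <;> simp [r, h]
  refine ⟨∑ y ∈ F, w y • r y, hconv.sum_mem hw0 hw1 hr, ?_, ?_⟩
  · simp only [map_sum, map_smul, hℓr, smul_eq_mul, ← Finset.sum_mul, hw1, one_mul]
  · calc c * ‖x - ∑ y ∈ F, w y • r y‖ = c * ‖∑ y ∈ F, w y • (y - r y)‖ := by
          rw [← hwx]; simp only [smul_sub, Finset.sum_sub_distrib]
      _ ≤ c * ∑ y ∈ F, w y * ‖y - r y‖ := by
          refine mul_le_mul_of_nonneg_left (norm_sum_le_of_le _ fun y hy => ?_) (le_of_lt hpos)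
          rw [norm_smul, Real.norm_of_nonneg (hw0 y hy)]
      _ = ∑ y ∈ F, w y * (c * ‖y - r y‖) := by
          rw [Finset.mul_sum]; exact Finset.sum_congr rfl fun _ _ => by ring
      _ ≤ ∑ y ∈ F, w y * (ℓ y - ℓ z₀) :=
          Finset.sum_le_sum fun y hy => mul_le_mul_of_nonneg_left (hc y hy) (hw0 y hy)
      _ = ℓ x - ℓ z₀ := by
          rw [← hwx]
          simp only [mul_sub, Finset.sum_sub_distrib, ← Finset.sum_mul, hw1, one_mul, map_sum,
            map_smul, smul_eq_mul]

/-- The payoff of the pure column `b` against `u`, as a linear functional of `u`. -/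
def colPayoff {nA nB : ℕ} (M : Matrix (Fin nA) (Fin nB) ℝ) (b : Fin nB) :
    EuclideanSpace ℝ (Fin nA) →ₗ[ℝ] ℝ where
  toFun u := ∑ a, u a * M a b
  map_add' u v := by simp [add_mul, Finset.sum_add_distrib]
  map_smul' r u := by simp [mul_assoc, Finset.mul_sum]

theorem maxOver_le_iff {nA nB : ℕ} [NeZero nB] (M : Matrix (Fin nA) (Fin nB) ℝ)
    (u : EuclideanSpace ℝ (Fin nA)) (t : ℝ) : maxOver M u ≤ t ↔ ∀ b, colPayoff M b u ≤ t := by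
  constructor
  · intro h b
    let e : simplex nB := ⟨WithLp.toLp 2 (Pi.single b 1), single_mem_stdSimplex ℝ b⟩
    have h1 := bilin_le_maxOver M u e
    rw [bilin_eq_right] at h1
    have h2 : ∑ b', (e : EuclideanSpace ℝ (Fin nB)) b' * ∑ a, u a * M a b' = colPayoff M b u := by
      rw [Finset.sum_eq_single b]
      · simp [e, colPayoff]
      · intro b' _ hb'
        simp [e, hb']
      · simp
    linarith
  · intro h
    refine ciSup_le fun w => ?_
    rw [bilin_eq_right]
    exact simplex_avg_le w h

/-- The epigraph makes the piecewise linear `maxOver` a linear objective. The cap `L` keeps the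
polyhedron bounded; the `Bool` indices split the equation `∑ u_a = 1` into two inequalities. -/
theorem exists_linear_epigraph_maxOver {nA nB : ℕ} [NeZero nB]
    (M : Matrix (Fin nA) (Fin nB) ℝ) (L : ℝ) :
    ∃ (f : (Fin nA ⊕ Bool) ⊕ (Fin nB ⊕ Unit) → (EuclideanSpace ℝ (Fin nA) × ℝ) →ₗ[ℝ] ℝ)
      (r : (Fin nA ⊕ Bool) ⊕ (Fin nB ⊕ Unit) → ℝ), ∀ p : EuclideanSpace ℝ (Fin nA) × ℝ,
      (∀ i, f i p ≤ r i) ↔ p.1 ∈ simplex nA ∧ maxOver M p.1 ≤ p.2 ∧ p.2 ≤ L := by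
  let coord : Fin nA → (EuclideanSpace ℝ (Fin nA) × ℝ) →ₗ[ℝ] ℝ := fun a =>
    (EuclideanSpace.proj a : EuclideanSpace ℝ (Fin nA) →L[ℝ] ℝ).toLinearMap ∘ₗ LinearMap.fst ℝ _ _
  let f : (Fin nA ⊕ Bool) ⊕ (Fin nB ⊕ Unit) → (EuclideanSpace ℝ (Fin nA) × ℝ) →ₗ[ℝ] ℝ :=
    Sum.elim (Sum.elim (fun a => -coord a) (fun i => if i then ∑ a, coord a else -∑ a, coord a))
      (Sum.elim (fun b => colPayoff M b ∘ₗ LinearMap.fst ℝ _ _ - LinearMap.snd ℝ _ _)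
        fun _ => LinearMap.snd ℝ _ _)
  let r : (Fin nA ⊕ Bool) ⊕ (Fin nB ⊕ Unit) → ℝ :=
    Sum.elim (Sum.elim (fun _ => 0) (fun i => if i then 1 else -1))
      (Sum.elim (fun _ => 0) fun _ => L)
  refine ⟨f, r, fun p => ?_⟩
  rw [maxOver_le_iff]
  constructor
  · intro h
    refine ⟨⟨fun a => ?_, ?_⟩, fun b => ?_, ?_⟩
    · simpa [f, r, coord] using h (Sum.inl (Sum.inl a))
    · have h1 := h (Sum.inl (Sum.inr true))
      have h2 := h (Sum.inl (Sum.inr false))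
      simp [f, r, coord] at h1 h2
      exact le_antisymm h1 h2
    · simpa [f, r] using h (Sum.inr (Sum.inl b))
    · simpa [f, r] using h (Sum.inr (Sum.inr ()))
  · rintro ⟨h1, h2, h3⟩ ((a | i) | (b | -))
    · simpa [f, r, coord] using h1.1 a
    · have := h1.2
      cases i <;> simp [f, r, coord, this]
    · simpa [f, r] using h2 b
    · simpa [f, r] using h3

theorem exists_sharp_maxOver {nA nB : ℕ} [NeZero nA] [NeZero nB]
    (M : Matrix (Fin nA) (Fin nB) ℝ) :
    ∃ c : ℝ, 0 < c ∧ ∀ u : simplex nA, ∃ v : simplex nA, maxOver M v = upperValue M ∧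
      c * ‖(u : EuclideanSpace ℝ (Fin nA)) - v‖ ≤ maxOver M u - upperValue M := by
  obtain ⟨L, hL⟩ := ((simplex_isCompact nA).image (continuous_maxOver M)).bddAbove
  have hL' : ∀ u : simplex nA, maxOver M u ≤ L := fun u => hL ⟨u, u.2, rfl⟩
  obtain ⟨f, r, hmem⟩ := exists_linear_epigraph_maxOver M L
  obtain ⟨u₀, hu₀, -⟩ := exists_maxOver_eq_upperValue M
  have hcompact : IsCompact {p : EuclideanSpace ℝ (Fin nA) × ℝ | ∀ i, f i p ≤ r i} := by
    refine IsCompact.of_isClosed_subset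
      ((simplex_isCompact nA).prod (isCompact_Icc (a := upperValue M) (b := L))) ?_ ?_
    · have : {p : EuclideanSpace ℝ (Fin nA) × ℝ | ∀ i, f i p ≤ r i} =
          {p | p.1 ∈ simplex nA} ∩ ({p | maxOver M p.1 ≤ p.2} ∩ {p | p.2 ≤ L}) := by
        ext p; exact hmem p
      rw [this]
      exact ((simplex_isCompact nA).isClosed.preimage continuous_fst).inter
        ((isClosed_le ((continuous_maxOver M).comp continuous_fst) continuous_snd).inter
          (isClosed_le continuous_snd continuous_const))
    · intro p hp
      obtain ⟨h1, h2, h3⟩ := (hmem p).1 hp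
      exact ⟨h1, (upperValue_le_maxOver M ⟨p.1, h1⟩).trans h2, h3⟩
  obtain ⟨c, hc, h⟩ := exists_sharp_minimum_polyhedron f r hcompact (LinearMap.snd ℝ _ _)
    (z₀ := ((u₀ : EuclideanSpace ℝ (Fin nA)), upperValue M))
    ((hmem _).2 ⟨u₀.2, hu₀.le, hu₀ ▸ hL' u₀⟩)
    (fun p hp => by
      obtain ⟨h1, h2, -⟩ := (hmem p).1 hp
      exact (upperValue_le_maxOver M ⟨p.1, h1⟩).trans h2)
  refine ⟨c, hc, fun u => ?_⟩
  obtain ⟨z, hz, hz1, hz2⟩ := h ((u : EuclideanSpace ℝ (Fin nA)), maxOver M u)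
    ((hmem _).2 ⟨u.2, le_rfl, hL' u⟩)
  obtain ⟨h1, h2, -⟩ := (hmem z).1 hz
  simp only [LinearMap.snd_apply] at hz1 hz2
  refine ⟨⟨z.1, h1⟩, le_antisymm (hz1 ▸ h2) (upperValue_le_maxOver M _), le_trans ?_ hz2⟩
  refine mul_le_mul_of_nonneg_left ?_ hc.le
  exact norm_fst_le (((u : EuclideanSpace ℝ (Fin nA)), maxOver M u) - z)

theorem bilin_neg_transpose {nA nB : ℕ} (M : Matrix (Fin nA) (Fin nB) ℝ)
    (u : EuclideanSpace ℝ (Fin nA)) (w : EuclideanSpace ℝ (Fin nB)) :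
    bilin (-M.transpose) w u = -bilin M u w := by
  simp only [bilin, Matrix.neg_apply, Matrix.transpose_apply]
  rw [Finset.sum_comm]
  simp only [← Finset.sum_neg_distrib]
  exact Finset.sum_congr rfl fun a _ => Finset.sum_congr rfl fun b _ => by ring

/-- Exchanging the players turns the max-player's problem into a min-player's problem, so the
sharpness result covers both. -/
theorem maxOver_neg_transpose {nA nB : ℕ} [NeZero nA] (M : Matrix (Fin nA) (Fin nB) ℝ)
    (w : EuclideanSpace ℝ (Fin nB)) : maxOver (-M.transpose) w = -minOver M w := by
  apply le_antisymm
  · refine ciSup_le fun u => ?_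
    rw [bilin_neg_transpose]
    exact neg_le_neg (minOver_le_bilin M u w)
  · obtain ⟨u, hu⟩ := exists_bilin_eq_minOver M w
    rw [← hu, ← bilin_neg_transpose]
    exact bilin_le_maxOver _ _ u

theorem dist_pairVec_le {nA nB : ℕ} (u u' : EuclideanSpace ℝ (Fin nA))
    (w w' : EuclideanSpace ℝ (Fin nB)) :
    dist (pairVec u w) (pairVec u' w') ≤ ‖u - u'‖ + ‖w - w'‖ := by
  rw [WithLp.prod_dist_eq_of_L2]
  simp only [dist_eq_norm]
  change √(‖u - u'‖ ^ 2 + ‖w - w'‖ ^ 2) ≤ _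
  refine Real.sqrt_le_iff.2 ⟨by positivity, ?_⟩
  nlinarith [norm_nonneg (u - u'), norm_nonneg (w - w')]

namespace MarkovGame

variable {nS nA nB : ℕ} (G : MarkovGame nS nA nB)

/-- The duality gap is the sum of the two players' suboptimalities and of upper minus lower value.
The last term is nonnegative by weak duality, and each suboptimality is sharp. -/
theorem exists_isErrorBound [NeZero nA] [NeZero nB] : ∃ c : ℝ, 0 < c ∧ G.IsErrorBound c := by
  choose c hc h using fun s => exists_sharp_maxOver (G.qStar s)
  choose c' hc' h' using fun s => exists_sharp_maxOver (-(G.qStar s).transpose)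
  have hev : ∀ᶠ e in nhdsWithin (0 : ℝ) (Set.Ioi 0), ∀ s, e ≤ c s ∧ e ≤ c' s := by
    refine Filter.eventually_all.2 fun s => ?_
    exact (((gt_mem_nhds (hc s)).and (gt_mem_nhds (hc' s))).filter_mono nhdsWithin_le_nhds).mono
      fun _ h => ⟨h.1.le, h.2.le⟩
  obtain ⟨e, he, hpos⟩ := (hev.and self_mem_nhdsWithin).exists
  refine ⟨e, hpos, fun x y s => ?_⟩
  have hpos : 0 < e := hpos
  obtain ⟨u, hu, hu'⟩ := h s (x s)
  obtain ⟨w, hw, hw'⟩ := h' s (y s)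
  have hweak : -upperValue (-(G.qStar s).transpose) ≤ upperValue (G.qStar s) := by
    rw [← hw, maxOver_neg_transpose, neg_neg]
    exact minOver_le_upperValue _ w
  rw [maxOver_neg_transpose] at hw hw'
  have hz : pairVec (u : EuclideanSpace ℝ (Fin nA)) (w : EuclideanSpace ℝ (Fin nB)) ∈
      G.zStarAt s := by
    refine ⟨⟨u.2, fun v hv => ?_⟩, w.2, fun v hv => ?_⟩
    · change maxOver _ _ ≤ maxOver _ _
      exact hu.trans_le (upperValue_le_maxOver _ ⟨v, hv⟩)
    · change minOver _ _ ≤ minOver _ _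
      have := upperValue_le_maxOver (-(G.qStar s).transpose) ⟨v, hv⟩
      rw [maxOver_neg_transpose, ← hw] at this
      exact neg_le_neg_iff.1 this
  have h1 := (Metric.infDist_le_dist_of_mem hz).trans
    (dist_pairVec_le (x s : EuclideanSpace ℝ (Fin nA)) u (y s : EuclideanSpace ℝ (Fin nB)) w)
  have h2 := mul_le_mul_of_nonneg_left h1 hpos.le
  have h3 := mul_le_mul_of_nonneg_right (he s).1
    (norm_nonneg ((x s : EuclideanSpace ℝ (Fin nA)) - u))
  have h4 := mul_le_mul_of_nonneg_right (he s).2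
    (norm_nonneg ((y s : EuclideanSpace ℝ (Fin nB)) - w))
  linarith

end MarkovGame

/-! ### Projections onto the simplex and the optimistic gradient step -/

theorem convex_simplex (n : ℕ) : Convex ℝ (simplex n) := by
  intro x hx y hy a b ha hb hab
  exact convex_stdSimplex ℝ (Fin n) hx hy ha hb hab

theorem inner_sub_projSimplex_le {n : ℕ} [NeZero n] (v : EuclideanSpace ℝ (Fin n))
    (q : simplex n) :
    inner ℝ (v - (projSimplex v : EuclideanSpace ℝ (Fin n)))
      ((q : EuclideanSpace ℝ (Fin n)) - projSimplex v) ≤ 0 := by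
  refine (norm_eq_iInf_iff_real_inner_le_zero (convex_simplex n) (projSimplex v).2).1 ?_ q q.2
  refine le_antisymm (le_ciInf fun q => Classical.choose_spec (exists_proj_simplex v) q) ?_
  exact ciInf_le ⟨0, by rintro _ ⟨q, rfl⟩; exact norm_nonneg _⟩ (projSimplex v)

/-- One step of optimistic gradient descent, from the variational inequalities of the two
projections `p` and `z'`. -/
theorem optimistic_step {F : Type*} [NormedAddCommGroup F] [InnerProductSpace ℝ F]
    {z p z' u g₀ g₁ : F} {η : ℝ} (hp : inner ℝ (z - η • g₀ - p) (z' - p) ≤ 0)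
    (hz' : inner ℝ (z - η • g₁ - z') (u - z') ≤ 0) :
    η * inner ℝ (p - u) g₁ ≤ 1 / 2 * ‖u - z‖ ^ 2 - 1 / 2 * ‖u - z'‖ ^ 2 + η ^ 2 * ‖g₁ - g₀‖ ^ 2 -
      1 / 4 * ‖p - z'‖ ^ 2 - 1 / 2 * ‖p - z‖ ^ 2 := by
  -- In the successive differences `A`, `B`, `C` everything becomes a quadratic form in a few inner
  -- products.
  obtain ⟨A, rfl⟩ : ∃ A, z = p + A := ⟨z - p, by abel⟩
  obtain ⟨B, rfl⟩ : ∃ B, p = z' + B := ⟨p - z', by abel⟩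
  obtain ⟨C, rfl⟩ : ∃ C, z' = u + C := ⟨z' - u, by abel⟩
  have e1 : u + C + B + A - η • g₀ - (u + C + B) = A - η • g₀ := by abel
  have e2 : u + C - (u + C + B) = -B := by abel
  have e3 : u + C + B + A - η • g₁ - (u + C) = A + B - η • g₁ := by abel
  have e4 : u - (u + C) = -C := by abel
  have e5 : u + C + B - u = B + C := by abel
  have e6 : u - (u + C + B + A) = -(A + B + C) := by abel
  have e7 : u + C + B - (u + C) = B := by abel
  have e8 : u + C + B - (u + C + B + A) = -A := by abel
  rw [e1, e2] at hp
  rw [e3, e4] at hz'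
  rw [e4, e5, e6, e7, e8]
  -- Young's inequality for `η⟨p - z', g₁ - g₀⟩`; it uses up `1/4` of the available `1/2 ‖p - z'‖²`.
  -- No sign of `η` enters, so the ascent step is the case of `-η`.
  have hY : 0 ≤ ‖(1 / 2 : ℝ) • B - η • (g₁ - g₀)‖ ^ 2 := by positivity
  simp only [← real_inner_self_eq_norm_sq, inner_sub_left, inner_sub_right, inner_add_left,
    inner_add_right, inner_neg_left, inner_neg_right, inner_smul_left, inner_smul_right,
    RCLike.conj_to_real] at *
  rw [real_inner_comm A B, real_inner_comm A C, real_inner_comm B C] at *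
  rw [real_inner_comm B g₁, real_inner_comm B g₀] at *
  rw [real_inner_comm C g₁, real_inner_comm g₀ g₁] at *
  nlinarith

theorem norm_sub_sq_le_two_of_simplex {n : ℕ} (p q : simplex n) :
    ‖(p : EuclideanSpace ℝ (Fin n)) - q‖ ^ 2 ≤ 2 := by
  have h1 : ∀ p : simplex n, ‖(p : EuclideanSpace ℝ (Fin n))‖ ^ 2 ≤ 1 := by
    intro p
    rw [EuclideanSpace.real_norm_sq_eq]
    have h : ∀ i, (p : EuclideanSpace ℝ (Fin n)) i ≤ 1 := fun i =>
      (Finset.single_le_sum (f := fun i => (p : EuclideanSpace ℝ (Fin n)) i)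
        (fun j _ => simplex_coord_nonneg p j) (Finset.mem_univ i)).trans (simplex_coord_sum p).le
    simpa only [sq] using simplex_avg_le p h
  have h2 : 0 ≤ inner ℝ (p : EuclideanSpace ℝ (Fin n)) q := by
    rw [PiLp.inner_apply]
    exact Finset.sum_nonneg fun i _ =>
      mul_nonneg (simplex_coord_nonneg q i) (simplex_coord_nonneg p i)
  rw [norm_sub_sq_real]
  linarith [h1 p, h1 q]

/-- Variation of `M w` when the matrix moves by at most `d` entrywise and `w` moves. -/
theorem norm_sq_mulVec_sub_le {n k : ℕ} {M M' : Fin n → Fin k → ℝ} {d m : ℝ}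
    (hd : ∀ a b, |M' a b - M a b| ≤ d) (hm : ∀ a b, |M a b| ≤ m) (w w' : simplex k) :
    ‖(WithLp.toLp 2 (fun a => ∑ b, M' a b * (w' : EuclideanSpace ℝ (Fin k)) b) :
        EuclideanSpace ℝ (Fin n)) -
      WithLp.toLp 2 (fun a => ∑ b, M a b * (w : EuclideanSpace ℝ (Fin k)) b)‖ ^ 2 ≤
    2 * n * d ^ 2 + 2 * (n * k) * m ^ 2 * ‖(w' : EuclideanSpace ℝ (Fin k)) - w‖ ^ 2 := by
  rw [EuclideanSpace.real_norm_sq_eq]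
  have key : ∀ a, (∑ b, M' a b * (w' : EuclideanSpace ℝ (Fin k)) b -
      ∑ b, M a b * (w : EuclideanSpace ℝ (Fin k)) b) ^ 2 ≤
      2 * d ^ 2 + 2 * k * m ^ 2 * ‖(w' : EuclideanSpace ℝ (Fin k)) - w‖ ^ 2 := by
    intro a
    -- The change is split into the movement of the matrix, averaged against `w'`, and the movement
    -- of `w`, bounded by Cauchy–Schwarz.
    set e₁ := ∑ b, (w' : EuclideanSpace ℝ (Fin k)) b * (M' a b - M a b) with he₁
    set e₂ := ∑ b, M a b * ((w' : EuclideanSpace ℝ (Fin k)) - w) b with he₂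
    have hsum : ∑ b, M' a b * (w' : EuclideanSpace ℝ (Fin k)) b -
        ∑ b, M a b * (w : EuclideanSpace ℝ (Fin k)) b = e₁ + e₂ := by
      rw [he₁, he₂, ← Finset.sum_sub_distrib, ← Finset.sum_add_distrib]
      exact Finset.sum_congr rfl fun b _ => by rw [PiLp.sub_apply]; ring
    have h1 : e₁ ≤ d := simplex_avg_le w' fun b => (abs_le.1 (hd a b)).2
    have h2 : -d ≤ e₁ := le_simplex_avg w' fun b => (abs_le.1 (hd a b)).1
    have h3 : e₂ ^ 2 ≤ k * m ^ 2 * ‖(w' : EuclideanSpace ℝ (Fin k)) - w‖ ^ 2 := by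
      rw [EuclideanSpace.real_norm_sq_eq]
      refine (Finset.sum_mul_sq_le_sq_mul_sq _ _ _).trans
        (mul_le_mul_of_nonneg_right ?_ (Finset.sum_nonneg fun _ _ => sq_nonneg _))
      calc ∑ b, M a b ^ 2 ≤ ∑ _b : Fin k, m ^ 2 :=
            Finset.sum_le_sum fun b _ => sq_le_sq.2 ((hm a b).trans (le_abs_self m))
        _ = k * m ^ 2 := by simp
    rw [hsum]
    nlinarith [sq_nonneg (e₁ - e₂)]
  refine (Finset.sum_le_sum fun a _ => key a).trans (le_of_eq ?_)
  simp only [Finset.sum_const, Finset.card_univ, Fintype.card_fin, nsmul_eq_mul]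
  ring

/-! ### Weighted averages with the weights `α_t^j` -/

/-- The average of `f 0, …, f (t-1)` with weights `α_t^{j+1}`. -/
def wavg (H : ℝ) (f : ℕ → ℝ) (t : ℕ) : ℝ :=
  ∑ j ∈ Finset.range t, alphaWeight H (j + 1) t * f j

theorem wavg_succ (H : ℝ) (f : ℕ → ℝ) (t : ℕ) :
    wavg H f (t + 1) = (1 - alphaStep H (t + 1)) * wavg H f t + alphaStep H (t + 1) * f t := by
  rw [wavg, Finset.sum_range_succ, wavg, Finset.mul_sum]
  congr 1
  · refine Finset.sum_congr rfl fun j hj => ?_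
    have hj := Finset.mem_range.1 hj
    rw [alphaWeight, alphaWeight, Finset.prod_Icc_succ_top (by omega)]
    ring
  · simp [alphaWeight]

/-- This is why the weights sum to one: the first update discards the empty average. -/
theorem alphaStep_one {H : ℝ} (hH : 1 ≤ H) : alphaStep H 1 = 1 := by
  have : H + 1 ≠ 0 := by positivity
  simp [alphaStep, div_self this]

theorem alphaStep_pos {H : ℝ} (hH : 1 ≤ H) (t : ℕ) : 0 < alphaStep H t := by
  unfold alphaStep; positivity

theorem alphaStep_succ_le_one {H : ℝ} (hH : 1 ≤ H) (t : ℕ) : alphaStep H (t + 1) ≤ 1 := by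
  unfold alphaStep
  rw [div_le_one (by positivity)]
  push_cast
  linarith [(Nat.cast_nonneg t : (0 : ℝ) ≤ t)]

theorem wavg_one {H : ℝ} (hH : 1 ≤ H) (f : ℕ → ℝ) : wavg H f 1 = f 0 := by
  rw [wavg_succ, zero_add, alphaStep_one hH]
  simp

theorem alphaWeight_nonneg {H : ℝ} (hH : 1 ≤ H) (j t : ℕ) : 0 ≤ alphaWeight H j t := by
  refine mul_nonneg (alphaStep_pos hH j).le (Finset.prod_nonneg fun k hk => ?_)
  obtain ⟨k, rfl⟩ := Nat.exists_eq_succ_of_ne_zero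
    (show k ≠ 0 by have := (Finset.mem_Icc.1 hk).1; omega)
  linarith [alphaStep_succ_le_one hH k]

theorem wavg_mono {H : ℝ} (hH : 1 ≤ H) {f g : ℕ → ℝ} {t : ℕ} (h : ∀ j < t, f j ≤ g j) :
    wavg H f t ≤ wavg H g t :=
  Finset.sum_le_sum fun j hj =>
    mul_le_mul_of_nonneg_left (h j (Finset.mem_range.1 hj)) (alphaWeight_nonneg hH _ _)

theorem wavg_const {H : ℝ} (hH : 1 ≤ H) (c : ℝ) (t : ℕ) : wavg H (fun _ => c) (t + 1) = c := by
  induction t with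
  | zero => exact wavg_one hH _
  | succ t ih => rw [wavg_succ, ih]; ring

theorem wavg_add (H : ℝ) (f g : ℕ → ℝ) (t : ℕ) :
    wavg H (fun j => f j + g j) t = wavg H f t + wavg H g t := by
  simp only [wavg, mul_add, Finset.sum_add_distrib]

theorem wavg_sub (H : ℝ) (f g : ℕ → ℝ) (t : ℕ) :
    wavg H (fun j => f j - g j) t = wavg H f t - wavg H g t := by
  simp only [wavg, mul_sub, Finset.sum_sub_distrib]

theorem wavg_const_mul (H c : ℝ) (f : ℕ → ℝ) (t : ℕ) :
    wavg H (fun j => c * f j) t = c * wavg H f t := by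
  simp only [wavg, Finset.mul_sum]
  exact Finset.sum_congr rfl fun _ _ => by ring

theorem wavg_sum {ι : Type*} (s : Finset ι) (H : ℝ) (f : ι → ℕ → ℝ) (t : ℕ) :
    wavg H (fun j => ∑ i ∈ s, f i j) t = ∑ i ∈ s, wavg H (f i) t := by
  simp only [wavg, Finset.mul_sum]
  exact Finset.sum_comm

theorem wavg_mem_Icc {H : ℝ} (hH : 1 ≤ H) {f : ℕ → ℝ} {t : ℕ} {a b : ℝ}
    (h : ∀ j < t + 1, f j ∈ Set.Icc a b) : wavg H f (t + 1) ∈ Set.Icc a b := by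
  constructor
  · rw [← wavg_const hH a t]; exact wavg_mono hH fun j hj => (h j hj).1
  · rw [← wavg_const hH b t]; exact wavg_mono hH fun j hj => (h j hj).2

/-- Averages of quantities controlled by the decrease of a potential. -/
theorem wavg_le_of_potential {H F Ψm : ℝ} (hH : 1 ≤ H) {f Ψ : ℕ → ℝ} (hF : 0 ≤ F) (h0 : f 0 ≤ F)
    (hΨ : ∀ t, Ψ t ≤ Ψm) (h : ∀ t, f (t + 1) ≤ Ψ t - Ψ (t + 1)) (t : ℕ) :
    wavg H f (t + 1) ≤ alphaStep H (t + 1) * (F + Ψm - Ψ t) := by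
  induction t with
  | zero => rw [wavg_one hH, zero_add, alphaStep_one hH]; linarith [hΨ 0]
  | succ t ih =>
    rw [wavg_succ]
    have h1 : 0 ≤ 1 - alphaStep H (t + 1 + 1) := by linarith [alphaStep_succ_le_one hH (t + 1)]
    -- The weights are nondecreasing in time, so the telescoping sum keeps only the newest weight.
    have h2 : (1 - alphaStep H (t + 1 + 1)) * alphaStep H (t + 1) ≤ alphaStep H (t + 1 + 1) := by
      have hp : (0 : ℝ) < H + t + 1 := by positivity
      have hq : (0 : ℝ) < H + t + 1 + 1 := by positivity
      have : (1 - alphaStep H (t + 1 + 1)) * alphaStep H (t + 1) =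
          alphaStep H (t + 1 + 1) * ((t + 1) / (H + t + 1)) := by
        unfold alphaStep
        push_cast
        rw [← add_assoc, ← add_assoc]
        field_simp
        ring
      rw [this]
      refine mul_le_of_le_one_right (alphaStep_pos hH _).le ?_
      rw [div_le_one hp]
      linarith
    have h3 : 0 ≤ F + Ψm - Ψ t := by linarith [hΨ t]
    calc _ ≤ (1 - alphaStep H (t + 1 + 1)) * (alphaStep H (t + 1) * (F + Ψm - Ψ t)) +
          alphaStep H (t + 1 + 1) * (Ψ t - Ψ (t + 1)) :=
          add_le_add (mul_le_mul_of_nonneg_left ih h1)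
            (mul_le_mul_of_nonneg_left (h t) (alphaStep_pos hH _).le)
      _ ≤ alphaStep H (t + 1 + 1) * (F + Ψm - Ψ t) +
          alphaStep H (t + 1 + 1) * (Ψ t - Ψ (t + 1)) := by
          rw [← mul_assoc]
          linarith [mul_le_mul_of_nonneg_right h2 h3]
      _ = _ := by ring

/-- Solution of the recursive inequality satisfied by the value gaps. -/
theorem wavg_le_of_recursion {H γ ρ : ℝ} (hH : 1 ≤ H) (hγ : (H + 1) * (1 - γ) = 2)
    {Γ : ℕ → ℝ} (h0 : Γ 0 ≤ ρ)
    (h : ∀ t, Γ (t + 1) ≤ γ * wavg H Γ (t + 1) + ρ / (H + (t + 1))) (t : ℕ) :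
    wavg H Γ (t + 1) ≤ (H + 1) * ρ / (H + (t + 1)) := by
  induction t with
  | zero =>
    rw [wavg_one hH]
    refine h0.trans (le_of_eq ?_)
    have : H + 1 ≠ 0 := by positivity
    simp only [CharP.cast_eq_zero, zero_add]
    field_simp
  | succ t ih =>
    have ht : (0 : ℝ) ≤ t := Nat.cast_nonneg t
    have hp : (0 : ℝ) < H + (t + 1) := by positivity
    have hq : (0 : ℝ) < H + (t + 1) + 1 := by positivity
    have hα : alphaStep H (t + 1 + 1) = (H + 1) / (H + (t + 1) + 1) := by
      unfold alphaStep; push_cast; ring_nf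
    -- The effective contraction factor of the average is `1 - 2/(N+1)` with `N = H+t+1`. The bound
    -- is then reproduced exactly, as `(1 - 2/(N+1))/N + 1/((N+1)N) = 1/(N+1)`.
    have hαγ : alphaStep H (t + 1 + 1) * (1 - γ) = 2 / (H + (t + 1) + 1) := by
      rw [hα, div_mul_eq_mul_div, hγ]
    have hcoef : 0 ≤ 1 - 2 / (H + (t + 1) + 1) := by
      rw [sub_nonneg, div_le_one hq]
      linarith
    rw [wavg_succ]
    calc _ ≤ (1 - alphaStep H (t + 1 + 1)) * wavg H Γ (t + 1) + alphaStep H (t + 1 + 1) *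
          (γ * wavg H Γ (t + 1) + ρ / (H + (t + 1))) := by
          linarith [mul_le_mul_of_nonneg_left (h t) (alphaStep_pos hH (t + 1 + 1)).le]
      _ = (1 - 2 / (H + (t + 1) + 1)) * wavg H Γ (t + 1) +
          alphaStep H (t + 1 + 1) * (ρ / (H + (t + 1))) := by rw [← hαγ]; ring
      _ ≤ (1 - 2 / (H + (t + 1) + 1)) * ((H + 1) * ρ / (H + (t + 1))) +
          alphaStep H (t + 1 + 1) * (ρ / (H + (t + 1))) := by
          linarith [mul_le_mul_of_nonneg_left ih hcoef]
      _ = (H + 1) * ρ / (H + (↑(t + 1) + 1)) := by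
          rw [hα]
          push_cast
          rw [← add_assoc H _ (1 : ℝ)]
          field_simp
          ring

theorem maxOver_le {nA nB : ℕ} [NeZero nB] {M : Matrix (Fin nA) (Fin nB) ℝ}
    {u : EuclideanSpace ℝ (Fin nA)} {t : ℝ} (h : ∀ b, ∑ a, M a b * u a ≤ t) :
    maxOver M u ≤ t := by
  refine ciSup_le fun w => ?_
  rw [bilin_eq_right]
  exact simplex_avg_le w fun b => by simpa only [mul_comm] using h b

theorem le_minOver {nA nB : ℕ} [NeZero nA] {M : Matrix (Fin nA) (Fin nB) ℝ}
    {w : EuclideanSpace ℝ (Fin nB)} {t : ℝ} (h : ∀ a, t ≤ ∑ b, M a b * w b) :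
    t ≤ minOver M w := by
  refine le_ciInf fun u => ?_
  rw [bilin_eq_left]
  exact le_simplex_avg u fun a => by simpa only [mul_comm] using h a

/-- The average of a sequence of points of the simplex with weights `α_{t+1}^{j+1}`. -/
def avgPoint {H : ℝ} (hH : 1 ≤ H) {n : ℕ} (p : ℕ → simplex n) (t : ℕ) : simplex n :=
  ⟨WithLp.toLp 2 fun i => wavg H (fun j => (p j : EuclideanSpace ℝ (Fin n)) i) (t + 1),
    fun i => (wavg_const hH 0 t).symm.le.trans
      (wavg_mono hH fun j _ => simplex_coord_nonneg (p j) i), by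
    change ∑ i, wavg H (fun j => (p j : EuclideanSpace ℝ (Fin n)) i) (t + 1) = 1
    rw [← wavg_sum]
    simp only [simplex_coord_sum]
    exact wavg_const hH 1 t⟩

/-- The vertex `i` of the simplex. -/
def vertex {n : ℕ} (i : Fin n) : simplex n :=
  ⟨EuclideanSpace.single i 1, single_mem_stdSimplex ℝ i⟩

theorem inner_vertex {n : ℕ} (i : Fin n) (g : EuclideanSpace ℝ (Fin n)) :
    inner ℝ (vertex i : EuclideanSpace ℝ (Fin n)) g = g i := by
  simp [vertex, EuclideanSpace.inner_single_left]

theorem abs_ciInf_sub_le {n : ℕ} [NeZero n] {f g : Fin n → ℝ} {d : ℝ}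
    (h : ∀ i, |f i - g i| ≤ d) : |(⨅ i, f i) - ⨅ i, g i| ≤ d := by
  have key : ∀ f g : Fin n → ℝ, (∀ i, |f i - g i| ≤ d) → (⨅ i, f i) - ⨅ i, g i ≤ d := by
    intro f g h
    obtain ⟨i, hi⟩ := exists_eq_ciInf_of_finite (f := g)
    have h1 : ⨅ i, f i ≤ f i := ciInf_le (Set.finite_range f).bddBelow i
    linarith [(abs_le.1 (h i)).2]
  refine abs_le.2 ⟨?_, key f g h⟩
  linarith [key g f fun i => by rw [abs_sub_comm]; exact h i]

theorem abs_ciSup_sub_le {n : ℕ} [NeZero n] {f g : Fin n → ℝ} {d : ℝ}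
    (h : ∀ i, |f i - g i| ≤ d) : |(⨆ i, f i) - ⨆ i, g i| ≤ d := by
  have key : ∀ f g : Fin n → ℝ, (∀ i, |f i - g i| ≤ d) → (⨆ i, f i) - ⨆ i, g i ≤ d := by
    intro f g h
    obtain ⟨i, hi⟩ := exists_eq_ciSup_of_finite (f := f)
    have h1 : g i ≤ ⨆ i, g i := le_ciSup (Set.finite_range g).bddAbove i
    linarith [(abs_le.1 (h i)).2]
  refine abs_le.2 ⟨?_, key f g h⟩
  linarith [key g f fun i => by rw [abs_sub_comm]; exact h i]

theorem ciInf_mem_Icc {n : ℕ} [NeZero n] {f : Fin n → ℝ} {a b : ℝ}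
    (h : ∀ i, f i ∈ Set.Icc a b) : ⨅ i, f i ∈ Set.Icc a b := by
  obtain ⟨i, hi⟩ := exists_eq_ciInf_of_finite (f := f)
  exact hi ▸ h i

theorem ciSup_mem_Icc {n : ℕ} [NeZero n] {f : Fin n → ℝ} {a b : ℝ}
    (h : ∀ i, f i ∈ Set.Icc a b) : ⨆ i, f i ∈ Set.Icc a b := by
  obtain ⟨i, hi⟩ := exists_eq_ciSup_of_finite (f := f)
  exact hi ▸ h i

/-- Averaging in one more value of `[0, m]` moves an average of values of `[0, m]` by at most
`α_{t+1} m`. -/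
theorem abs_wavg_succ_sub_le {H m : ℝ} (hH : 1 ≤ H) {f : ℕ → ℝ} (hf : ∀ j, f j ∈ Set.Icc 0 m)
    (t : ℕ) : |wavg H f (t + 1 + 1) - wavg H f (t + 1)| ≤ m * alphaStep H (t + 1 + 1) := by
  have h1 := wavg_mem_Icc hH (t := t) fun j _ => hf j
  have h2 := hf (t + 1)
  have : wavg H f (t + 1 + 1) - wavg H f (t + 1) =
      alphaStep H (t + 1 + 1) * (f (t + 1) - wavg H f (t + 1)) := by rw [wavg_succ]; ring
  rw [this, abs_mul, abs_of_pos (alphaStep_pos hH _), mul_comm]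
  refine mul_le_mul_of_nonneg_right (abs_le.2 ⟨?_, ?_⟩) (alphaStep_pos hH _).le
  · linarith [h1.2, h2.1]
  · linarith [h1.1, h2.2]

/-! ### Averaging OGDA: value brackets and the gap recursion -/

namespace MarkovGame

variable {nS nA nB : ℕ} (G : MarkovGame nS nA nB)

theorem horizon_add_one : G.horizon + 1 = 2 * (1 / (1 - G.γ)) := by
  have := G.one_sub_gamma_pos.ne'
  unfold horizon
  field_simp
  ring

theorem one_le_inv_one_sub_gamma : 1 ≤ 1 / (1 - G.γ) := by
  rw [le_div_iff₀ G.one_sub_gamma_pos]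
  linarith [G.γ_nonneg]

theorem one_le_horizon : 1 ≤ G.horizon := by
  linarith [G.horizon_add_one, G.one_le_inv_one_sub_gamma]

theorem qLo_apply (V : Fin nS → ℝ) (y : Policy nS nB) (s : Fin nS) (a : Fin nA) :
    G.qLo V y s a = ∑ b, G.bellman V s a b * (y s : EuclideanSpace ℝ (Fin nB)) b := rfl

theorem qHi_apply (V : Fin nS → ℝ) (x : Policy nS nA) (s : Fin nS) (b : Fin nB) :
    G.qHi V x s b = ∑ a, G.bellman V s a b * (x s : EuclideanSpace ℝ (Fin nA)) a := rfl

theorem bellman_mem_Icc {V : Fin nS → ℝ} (h : ∀ s, V s ∈ Set.Icc 0 (1 / (1 - G.γ))) (s : Fin nS)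
    (a : Fin nA) (b : Fin nB) : G.bellman V s a b ∈ Set.Icc 0 (1 / (1 - G.γ)) :=
  ⟨G.bellman_nonneg (fun s => (h s).1) s a b, G.bellman_le (fun s => (h s).2) s a b⟩

theorem qLo_mem_Icc {V : Fin nS → ℝ} (h : ∀ s, V s ∈ Set.Icc 0 (1 / (1 - G.γ)))
    (y : Policy nS nB) (s : Fin nS) (a : Fin nA) :
    G.qLo V y s a ∈ Set.Icc 0 (1 / (1 - G.γ)) := by
  simp only [qLo_apply, mul_comm (G.bellman V s a _)]
  exact ⟨le_simplex_avg _ fun b => (G.bellman_mem_Icc h s a b).1,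
    simplex_avg_le _ fun b => (G.bellman_mem_Icc h s a b).2⟩

theorem qHi_mem_Icc {V : Fin nS → ℝ} (h : ∀ s, V s ∈ Set.Icc 0 (1 / (1 - G.γ)))
    (x : Policy nS nA) (s : Fin nS) (b : Fin nB) :
    G.qHi V x s b ∈ Set.Icc 0 (1 / (1 - G.γ)) := by
  simp only [qHi_apply, mul_comm (G.bellman V s _ b)]
  exact ⟨le_simplex_avg _ fun a => (G.bellman_mem_Icc h s a b).1,
    simplex_avg_le _ fun a => (G.bellman_mem_Icc h s a b).2⟩

theorem inner_qLo (V : Fin nS → ℝ) (x : Policy nS nA) (y : Policy nS nB) (s : Fin nS) :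
    inner ℝ (x s : EuclideanSpace ℝ (Fin nA)) (G.qLo V y s) =
      bilin (G.bellman V s) (x s) (y s) := by
  rw [bilin_eq_left, PiLp.inner_apply]
  refine Finset.sum_congr rfl fun a _ => ?_
  simp [qLo_apply, mul_comm]

theorem inner_qHi (V : Fin nS → ℝ) (x : Policy nS nA) (y : Policy nS nB) (s : Fin nS) :
    inner ℝ (y s : EuclideanSpace ℝ (Fin nB)) (G.qHi V x s) =
      bilin (G.bellman V s) (x s) (y s) := by
  rw [bilin_eq_right, PiLp.inner_apply]
  refine Finset.sum_congr rfl fun a _ => ?_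
  simp [qHi_apply, mul_comm]

theorem bellman_mono {v v' : Fin nS → ℝ} (h : ∀ s, v s ≤ v' s) (s : Fin nS) (a : Fin nA)
    (b : Fin nB) : G.bellman v s a b ≤ G.bellman v' s a b := by
  simpa using G.bellman_le_add (d := 0) (fun s => by simpa using h s) s a b

theorem abs_bellman_sub_le {v v' : Fin nS → ℝ} {d : ℝ} (h : ∀ s, |v s - v' s| ≤ d) (s : Fin nS)
    (a : Fin nA) (b : Fin nB) : |G.bellman v s a b - G.bellman v' s a b| ≤ d := by
  have h0 : 0 ≤ d := (abs_nonneg _).trans (h s)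
  have h1 := G.bellman_le_add (v := v) (v' := v') (d := d)
    (fun s => by linarith [(abs_le.1 (h s)).2]) s a b
  have h2 := G.bellman_le_add (v := v') (v' := v) (d := d)
    (fun s => by linarith [(abs_le.1 (h s)).1]) s a b
  have h3 : G.γ * d ≤ d := mul_le_of_le_one_left h0 G.γ_lt_one.le
  exact abs_le.2 ⟨by linarith, by linarith⟩

theorem norm_sq_qLo_sub_le {V V' : Fin nS → ℝ} {d : ℝ}
    (hV : ∀ s, V s ∈ Set.Icc 0 (1 / (1 - G.γ))) (hd : ∀ s, |V' s - V s| ≤ d)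
    (y y' : Policy nS nB) (s : Fin nS) :
    ‖G.qLo V' y' s - G.qLo V y s‖ ^ 2 ≤ 2 * nA * d ^ 2 +
      2 * (nA * nB) * (1 / (1 - G.γ)) ^ 2 * ‖(y' s : EuclideanSpace ℝ (Fin nB)) - y s‖ ^ 2 :=
  norm_sq_mulVec_sub_le (M := G.bellman V s) (M' := G.bellman V' s)
    (fun a b => G.abs_bellman_sub_le hd s a b)
    (fun a b => by
      obtain ⟨h1, h2⟩ := G.bellman_mem_Icc hV s a b
      rwa [abs_of_nonneg h1]) (y s) (y' s)

theorem norm_sq_qHi_sub_le {V V' : Fin nS → ℝ} {d : ℝ}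
    (hV : ∀ s, V s ∈ Set.Icc 0 (1 / (1 - G.γ))) (hd : ∀ s, |V' s - V s| ≤ d)
    (x x' : Policy nS nA) (s : Fin nS) :
    ‖G.qHi V' x' s - G.qHi V x s‖ ^ 2 ≤ 2 * nB * d ^ 2 +
      2 * (nB * nA) * (1 / (1 - G.γ)) ^ 2 * ‖(x' s : EuclideanSpace ℝ (Fin nA)) - x s‖ ^ 2 :=
  norm_sq_mulVec_sub_le (M := fun b a => G.bellman V s a b) (M' := fun b a => G.bellman V' s a b)
    (fun b a => G.abs_bellman_sub_le hd s a b)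
    (fun b a => by
      obtain ⟨h1, h2⟩ := G.bellman_mem_Icc hV s a b
      rwa [abs_of_nonneg h1]) (x s) (x' s)

variable [NeZero nA] [NeZero nB] (η : ℝ) (xin : Policy nS nA) (yin : Policy nS nB)

theorem aogda_zero : G.aogda η xin yin 0 = ⟨xin, yin, xin, yin, G.valueMin yin, G.valueMax xin⟩ := by
  rw [aogda]

theorem aogda_succ_Vlo (n : ℕ) (s : Fin nS) : (G.aogda η xin yin (n + 1)).Vlo s =
    ⨅ a, wavg G.horizon (fun j => G.qLo (G.aogda η xin yin j).Vlo (G.aogda η xin yin j).y s a)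
      (n + 1) := by
  rw [aogda]
  refine iInf_congr fun a => ?_
  rw [wavg, ← Fin.sum_univ_eq_sum_range (fun j => alphaWeight G.horizon (j + 1) (n + 1) *
    G.qLo (G.aogda η xin yin j).Vlo (G.aogda η xin yin j).y s a)]

theorem aogda_succ_Vhi (n : ℕ) (s : Fin nS) : (G.aogda η xin yin (n + 1)).Vhi s =
    ⨆ b, wavg G.horizon (fun j => G.qHi (G.aogda η xin yin j).Vhi (G.aogda η xin yin j).x s b)
      (n + 1) := by
  rw [aogda]
  refine iSup_congr fun b => ?_
  rw [wavg, ← Fin.sum_univ_eq_sum_range (fun j => alphaWeight G.horizon (j + 1) (n + 1) *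
    G.qHi (G.aogda η xin yin j).Vhi (G.aogda η xin yin j).x s b)]

theorem aogda_succ_x (n : ℕ) (s : Fin nS) : (G.aogda η xin yin (n + 1)).x s =
    projSimplex (((G.aogda η xin yin n).xt s : EuclideanSpace ℝ (Fin nA)) -
      η • G.qLo (G.aogda η xin yin n).Vlo (G.aogda η xin yin n).y s) := by
  rw [aogda]

theorem aogda_succ_y (n : ℕ) (s : Fin nS) : (G.aogda η xin yin (n + 1)).y s =
    projSimplex (((G.aogda η xin yin n).yt s : EuclideanSpace ℝ (Fin nB)) +
      η • G.qHi (G.aogda η xin yin n).Vhi (G.aogda η xin yin n).x s) := by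
  rw [aogda]

theorem aogda_succ_xt (n : ℕ) (s : Fin nS) : (G.aogda η xin yin (n + 1)).xt s =
    projSimplex (((G.aogda η xin yin n).xt s : EuclideanSpace ℝ (Fin nA)) -
      η • G.qLo (G.aogda η xin yin (n + 1)).Vlo (G.aogda η xin yin (n + 1)).y s) := by
  rw [aogda]

theorem aogda_succ_yt (n : ℕ) (s : Fin nS) : (G.aogda η xin yin (n + 1)).yt s =
    projSimplex (((G.aogda η xin yin n).yt s : EuclideanSpace ℝ (Fin nB)) +
      η • G.qHi (G.aogda η xin yin (n + 1)).Vhi (G.aogda η xin yin (n + 1)).x s) := by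
  rw [aogda]

/-- The averaged policy of the min-player after `n` updates. -/
def avgX (n : ℕ) (s : Fin nS) : simplex nA :=
  avgPoint G.one_le_horizon (fun j => (G.aogda η xin yin j).x s) n

/-- The averaged policy of the max-player after `n` updates. -/
def avgY (n : ℕ) (s : Fin nS) : simplex nB :=
  avgPoint G.one_le_horizon (fun j => (G.aogda η xin yin j).y s) n

/-- Policies and payoffs carry the same weights, so by linearity the claim reduces to `Q*_s ≤
Q_s[Vhi^j]` for each `j`. The average over `0, …, n` meets the estimate of index `n+1`. -/
theorem maxOver_avgX_le (n : ℕ) (h : ∀ j < n + 1, ∀ s, G.gameValue s ≤ (G.aogda η xin yin j).Vhi s)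
    (s : Fin nS) :
    maxOver (G.qStar s) (G.avgX η xin yin n s) ≤ (G.aogda η xin yin (n + 1)).Vhi s := by
  refine maxOver_le fun b => ?_
  rw [aogda_succ_Vhi]
  refine le_trans ?_ (le_ciSup (Set.finite_range _).bddAbove b)
  change ∑ a, G.qStar s a b * wavg G.horizon _ (n + 1) ≤ _
  simp only [← wavg_const_mul, ← wavg_sum]
  refine wavg_mono G.one_le_horizon fun j hj => Finset.sum_le_sum fun a _ => ?_
  exact mul_le_mul_of_nonneg_right (G.bellman_mono (h j hj) s a b) (simplex_coord_nonneg _ a)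

theorem le_minOver_avgY (n : ℕ) (h : ∀ j < n + 1, ∀ s, (G.aogda η xin yin j).Vlo s ≤ G.gameValue s)
    (s : Fin nS) :
    (G.aogda η xin yin (n + 1)).Vlo s ≤ minOver (G.qStar s) (G.avgY η xin yin n s) := by
  refine le_minOver fun a => ?_
  rw [aogda_succ_Vlo]
  refine le_trans (ciInf_le (Set.finite_range _).bddBelow a) ?_
  change _ ≤ ∑ b, G.qStar s a b * wavg G.horizon _ (n + 1)
  simp only [← wavg_const_mul, ← wavg_sum]
  refine wavg_mono G.one_le_horizon fun j hj => ?_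
  rw [qLo_apply]
  refine Finset.sum_le_sum fun b _ => ?_
  exact mul_le_mul_of_nonneg_right (G.bellman_mono (h j hj) s a b) (simplex_coord_nonneg _ b)

/-- The largest gap between the upper and the lower value estimates. -/
def valueGap (n : ℕ) : ℝ := ⨆ s, ((G.aogda η xin yin n).Vhi s - (G.aogda η xin yin n).Vlo s)

theorem le_valueGap (n : ℕ) (s : Fin nS) :
    (G.aogda η xin yin n).Vhi s - (G.aogda η xin yin n).Vlo s ≤ G.valueGap η xin yin n :=
  le_ciSup (f := fun s => (G.aogda η xin yin n).Vhi s - (G.aogda η xin yin n).Vlo s)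
    (Set.finite_range _).bddAbove s

/-- Instantaneous regret of the two players at the state `s` against the actions `a`, `b`. -/
def regret (s : Fin nS) (a : Fin nA) (b : Fin nB) (j : ℕ) : ℝ :=
  inner ℝ (((G.aogda η xin yin j).x s : EuclideanSpace ℝ (Fin nA)) - vertex a)
      (G.qLo (G.aogda η xin yin j).Vlo (G.aogda η xin yin j).y s) -
    inner ℝ (((G.aogda η xin yin j).y s : EuclideanSpace ℝ (Fin nB)) - vertex b)
      (G.qHi (G.aogda η xin yin j).Vhi (G.aogda η xin yin j).x s)

theorem regret_eq (s : Fin nS) (a : Fin nA) (b : Fin nB) (j : ℕ) :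
    G.regret η xin yin s a b j =
      (G.qHi (G.aogda η xin yin j).Vhi (G.aogda η xin yin j).x s b -
        G.qLo (G.aogda η xin yin j).Vlo (G.aogda η xin yin j).y s a) -
      (bilin (G.bellman (G.aogda η xin yin j).Vhi s) ((G.aogda η xin yin j).x s)
          ((G.aogda η xin yin j).y s) -
        bilin (G.bellman (G.aogda η xin yin j).Vlo s) ((G.aogda η xin yin j).x s)
          ((G.aogda η xin yin j).y s)) := by
  rw [regret, inner_sub_left, inner_sub_left, inner_vertex, inner_vertex, inner_qLo, inner_qHi]
  ring

theorem optimistic_step_x (s : Fin nS) (u : simplex nA) (t : ℕ) :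
    η * inner ℝ (((G.aogda η xin yin (t + 1)).x s : EuclideanSpace ℝ (Fin nA)) - u)
      (G.qLo (G.aogda η xin yin (t + 1)).Vlo (G.aogda η xin yin (t + 1)).y s) ≤
    1 / 2 * ‖(u : EuclideanSpace ℝ (Fin nA)) - (G.aogda η xin yin t).xt s‖ ^ 2 -
      1 / 2 * ‖(u : EuclideanSpace ℝ (Fin nA)) - (G.aogda η xin yin (t + 1)).xt s‖ ^ 2 +
      η ^ 2 * ‖G.qLo (G.aogda η xin yin (t + 1)).Vlo (G.aogda η xin yin (t + 1)).y s -
        G.qLo (G.aogda η xin yin t).Vlo (G.aogda η xin yin t).y s‖ ^ 2 -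
      1 / 4 * ‖((G.aogda η xin yin (t + 1)).x s : EuclideanSpace ℝ (Fin nA)) -
        (G.aogda η xin yin (t + 1)).xt s‖ ^ 2 -
      1 / 2 * ‖((G.aogda η xin yin (t + 1)).x s : EuclideanSpace ℝ (Fin nA)) -
        (G.aogda η xin yin t).xt s‖ ^ 2 := by
  refine optimistic_step ?_ ?_
  · rw [aogda_succ_x]
    exact inner_sub_projSimplex_le _ _
  · rw [aogda_succ_xt]
    exact inner_sub_projSimplex_le _ _

theorem optimistic_step_y (s : Fin nS) (w : simplex nB) (t : ℕ) :
    -(η * inner ℝ (((G.aogda η xin yin (t + 1)).y s : EuclideanSpace ℝ (Fin nB)) - w)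
      (G.qHi (G.aogda η xin yin (t + 1)).Vhi (G.aogda η xin yin (t + 1)).x s)) ≤
    1 / 2 * ‖(w : EuclideanSpace ℝ (Fin nB)) - (G.aogda η xin yin t).yt s‖ ^ 2 -
      1 / 2 * ‖(w : EuclideanSpace ℝ (Fin nB)) - (G.aogda η xin yin (t + 1)).yt s‖ ^ 2 +
      η ^ 2 * ‖G.qHi (G.aogda η xin yin (t + 1)).Vhi (G.aogda η xin yin (t + 1)).x s -
        G.qHi (G.aogda η xin yin t).Vhi (G.aogda η xin yin t).x s‖ ^ 2 -
      1 / 4 * ‖((G.aogda η xin yin (t + 1)).y s : EuclideanSpace ℝ (Fin nB)) -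
        (G.aogda η xin yin (t + 1)).yt s‖ ^ 2 -
      1 / 2 * ‖((G.aogda η xin yin (t + 1)).y s : EuclideanSpace ℝ (Fin nB)) -
        (G.aogda η xin yin t).yt s‖ ^ 2 := by
  have h := optimistic_step (F := EuclideanSpace ℝ (Fin nB)) (η := -η)
    (z := (G.aogda η xin yin t).yt s) (p := (G.aogda η xin yin (t + 1)).y s)
    (z' := (G.aogda η xin yin (t + 1)).yt s) (u := w)
    (g₀ := G.qHi (G.aogda η xin yin t).Vhi (G.aogda η xin yin t).x s)
    (g₁ := G.qHi (G.aogda η xin yin (t + 1)).Vhi (G.aogda η xin yin (t + 1)).x s) ?_ ?_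
  · rwa [neg_sq, neg_mul] at h
  · rw [neg_smul, sub_neg_eq_add, aogda_succ_y]
    exact inner_sub_projSimplex_le _ _
  · rw [neg_smul, sub_neg_eq_add, aogda_succ_yt]
    exact inner_sub_projSimplex_le _ _

variable [NeZero nS]

theorem aogda_Vlo_mem_Icc (n : ℕ) (s : Fin nS) :
    (G.aogda η xin yin n).Vlo s ∈ Set.Icc 0 (1 / (1 - G.γ)) := by
  induction n using Nat.strong_induction_on generalizing s with
  | _ n ih =>
    cases n with
    | zero => rw [aogda_zero]; exact ⟨G.valueMin_nonneg yin s, G.valueMin_le yin s⟩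
    | succ n =>
      rw [aogda_succ_Vlo]
      exact ciInf_mem_Icc fun a => wavg_mem_Icc G.one_le_horizon fun j hj =>
        G.qLo_mem_Icc (ih j hj) _ s a

theorem aogda_Vhi_mem_Icc (n : ℕ) (s : Fin nS) :
    (G.aogda η xin yin n).Vhi s ∈ Set.Icc 0 (1 / (1 - G.γ)) := by
  induction n using Nat.strong_induction_on generalizing s with
  | _ n ih =>
    cases n with
    | zero => rw [aogda_zero]; exact ⟨G.valueMax_nonneg xin s, G.valueMax_le xin s⟩
    | succ n =>
      rw [aogda_succ_Vhi]
      exact ciSup_mem_Icc fun b => wavg_mem_Icc G.one_le_horizon fun j hj =>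
        G.qHi_mem_Icc (ih j hj) _ s b

theorem abs_aogda_Vlo_succ_sub_le (n : ℕ) (s : Fin nS) :
    |(G.aogda η xin yin (n + 1)).Vlo s - (G.aogda η xin yin n).Vlo s| ≤
      1 / (1 - G.γ) * alphaStep G.horizon (n + 1) := by
  cases n with
  -- The initial estimate is a best-response value and not an average; here `α_1 = 1`, and the range
  -- `[0, 1/(1-γ)]` suffices.
  | zero =>
    rw [zero_add, alphaStep_one G.one_le_horizon, mul_one]
    have h0 := G.aogda_Vlo_mem_Icc η xin yin 0 s
    have h1 := G.aogda_Vlo_mem_Icc η xin yin 1 s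
    exact abs_le.2 ⟨by linarith [h0.2, h1.1], by linarith [h0.1, h1.2]⟩
  | succ n =>
    rw [aogda_succ_Vlo, aogda_succ_Vlo]
    exact abs_ciInf_sub_le fun a => abs_wavg_succ_sub_le G.one_le_horizon
      (fun j => G.qLo_mem_Icc (G.aogda_Vlo_mem_Icc η xin yin j) _ s a) n

theorem abs_aogda_Vhi_succ_sub_le (n : ℕ) (s : Fin nS) :
    |(G.aogda η xin yin (n + 1)).Vhi s - (G.aogda η xin yin n).Vhi s| ≤
      1 / (1 - G.γ) * alphaStep G.horizon (n + 1) := by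
  cases n with
  | zero =>
    rw [zero_add, alphaStep_one G.one_le_horizon, mul_one]
    have h0 := G.aogda_Vhi_mem_Icc η xin yin 0 s
    have h1 := G.aogda_Vhi_mem_Icc η xin yin 1 s
    exact abs_le.2 ⟨by linarith [h0.2, h1.1], by linarith [h0.1, h1.2]⟩
  | succ n =>
    rw [aogda_succ_Vhi, aogda_succ_Vhi]
    exact abs_ciSup_sub_le fun b => abs_wavg_succ_sub_le G.one_le_horizon
      (fun j => G.qHi_mem_Icc (G.aogda_Vhi_mem_Icc η xin yin j) _ s b) n

/-- By Shapley's equation `v*` is at most what the averaged policy concedes in `Q*_s`, which the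
estimate dominates as long as the earlier estimates lie above `v*`. -/
theorem gameValue_le_aogda_Vhi (n : ℕ) (s : Fin nS) :
    G.gameValue s ≤ (G.aogda η xin yin n).Vhi s := by
  induction n using Nat.strong_induction_on generalizing s with
  | _ n ih =>
    cases n with
    | zero => rw [aogda_zero]; exact G.gameValue_le_valueMax xin s
    | succ n =>
      rw [gameValue_eq_upperValue]
      exact (upperValue_le_maxOver _ _).trans (G.maxOver_avgX_le η xin yin n ih s)

theorem aogda_Vlo_le_gameValue (n : ℕ) (s : Fin nS) :
    (G.aogda η xin yin n).Vlo s ≤ G.gameValue s := by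
  induction n using Nat.strong_induction_on generalizing s with
  | _ n ih =>
    cases n with
    | zero => rw [aogda_zero]; exact G.valueMin_le_gameValue yin s
    | succ n =>
      rw [gameValue_eq_upperValue]
      exact (G.le_minOver_avgY η xin yin n ih s).trans (minOver_le_upperValue _ _)

/-- The duality gap of the averaged policies is at most the gap between the value estimates. -/
theorem gap_avg_le (n : ℕ) (s : Fin nS) :
    maxOver (G.qStar s) (G.avgX η xin yin n s) - minOver (G.qStar s) (G.avgY η xin yin n s) ≤
      (G.aogda η xin yin (n + 1)).Vhi s - (G.aogda η xin yin (n + 1)).Vlo s :=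
  sub_le_sub (G.maxOver_avgX_le η xin yin n (fun j _ => G.gameValue_le_aogda_Vhi η xin yin j) s)
    (G.le_minOver_avgY η xin yin n (fun j _ => G.aogda_Vlo_le_gameValue η xin yin j) s)

/-- The state and the two pure actions attaining the extrema at step `n+1` are held fixed over all
earlier times. The players use different matrices, so their payoffs do not cancel; the discrepancy
at time `j` is at most `γ` times the gap there. -/
theorem exists_valueGap_succ_le (n : ℕ) : ∃ s a b, G.valueGap η xin yin (n + 1) ≤
    G.γ * wavg G.horizon (G.valueGap η xin yin) (n + 1) +
      wavg G.horizon (G.regret η xin yin s a b) (n + 1) := by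
  obtain ⟨s, hs⟩ := exists_eq_ciSup_of_finite (f := fun s =>
    (G.aogda η xin yin (n + 1)).Vhi s - (G.aogda η xin yin (n + 1)).Vlo s)
  obtain ⟨a, ha⟩ := exists_eq_ciInf_of_finite (f := fun a => wavg G.horizon
    (fun j => G.qLo (G.aogda η xin yin j).Vlo (G.aogda η xin yin j).y s a) (n + 1))
  obtain ⟨b, hb⟩ := exists_eq_ciSup_of_finite (f := fun b => wavg G.horizon
    (fun j => G.qHi (G.aogda η xin yin j).Vhi (G.aogda η xin yin j).x s b) (n + 1))
  refine ⟨s, a, b, ?_⟩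
  rw [valueGap, ← hs, aogda_succ_Vhi, aogda_succ_Vlo, ← ha, ← hb, ← wavg_sub, ← wavg_const_mul,
    ← wavg_add]
  refine wavg_mono G.one_le_horizon fun j _ => ?_
  rw [regret_eq]
  have h := bilin_le_add (G.bellman_le_add (v := (G.aogda η xin yin j).Vhi)
    (v' := (G.aogda η xin yin j).Vlo) (d := G.valueGap η xin yin j)
    (fun s => by linarith [G.le_valueGap η xin yin j s]) s)
    ((G.aogda η xin yin j).x s) ((G.aogda η xin yin j).y s)
  linarith

end MarkovGame

/-! ### The potential, the averaged regret and the rate of the value gap -/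

namespace MarkovGame

variable {nS nA nB : ℕ} (G : MarkovGame nS nA nB) [NeZero nA] [NeZero nB]
  (η : ℝ) (xin : Policy nS nA) (yin : Policy nS nB)

/-- The potential that controls the regret of the two players. -/
def potential (s : Fin nS) (a : Fin nA) (b : Fin nB) (t : ℕ) : ℝ :=
  (1 / 2 * ‖(vertex a : EuclideanSpace ℝ (Fin nA)) - (G.aogda η xin yin t).xt s‖ ^ 2 +
    1 / 2 * ‖(vertex b : EuclideanSpace ℝ (Fin nB)) - (G.aogda η xin yin t).yt s‖ ^ 2 +
    1 / 64 * ‖((G.aogda η xin yin t).x s : EuclideanSpace ℝ (Fin nA)) -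
      (G.aogda η xin yin t).xt s‖ ^ 2 +
    1 / 64 * ‖((G.aogda η xin yin t).y s : EuclideanSpace ℝ (Fin nB)) -
      (G.aogda η xin yin t).yt s‖ ^ 2) / η + (1 / (1 - G.γ)) ^ 3 / (G.horizon + t)

theorem potential_nonneg (hη : 0 < η) (s : Fin nS) (a : Fin nA) (b : Fin nB) (t : ℕ) :
    0 ≤ G.potential η xin yin s a b t := by
  have h1 := G.one_le_horizon
  have h2 := G.one_le_inv_one_sub_gamma
  unfold potential
  positivity

theorem potential_le (hη : 0 < η) (s : Fin nS) (a : Fin nA) (b : Fin nB) (t : ℕ) :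
    G.potential η xin yin s a b t ≤ 3 / η + (1 / (1 - G.γ)) ^ 2 := by
  have h2 := G.one_le_inv_one_sub_gamma
  have h3 := G.horizon_add_one
  unfold potential
  refine add_le_add (div_le_div_of_nonneg_right ?_ hη.le) ?_
  · have e1 := norm_sub_sq_le_two_of_simplex (vertex a) ((G.aogda η xin yin t).xt s)
    have e2 := norm_sub_sq_le_two_of_simplex (vertex b) ((G.aogda η xin yin t).yt s)
    have e3 := norm_sub_sq_le_two_of_simplex ((G.aogda η xin yin t).x s)
      ((G.aogda η xin yin t).xt s)
    have e4 := norm_sub_sq_le_two_of_simplex ((G.aogda η xin yin t).y s)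
      ((G.aogda η xin yin t).yt s)
    linarith
  · have ht : (0 : ℝ) ≤ t := Nat.cast_nonneg t
    rw [div_le_iff₀ (by linarith), pow_succ]
    exact mul_le_mul_of_nonneg_left (by linarith) (by positivity)

theorem norm_sub_sq_le_two_mul {F : Type*} [NormedAddCommGroup F] [InnerProductSpace ℝ F]
    (p q z : F) : ‖p - q‖ ^ 2 ≤ 2 * ‖p - z‖ ^ 2 + 2 * ‖q - z‖ ^ 2 := by
  have h1 : p - q = (p - z) - (q - z) := by abel
  have h2 := parallelogram_law_with_norm ℝ (p - z) (q - z)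
  rw [h1]
  nlinarith [sq_nonneg ‖(p - z) + (q - z)‖]

/-- Real-number form of the second-order estimate of the optimistic step. -/
theorem second_order_le {η m A B k α D g : ℝ} (hη : 0 < η) (hm : 1 ≤ m)
    (hB : 0 ≤ B) (hmA : η * m * A ≤ 1 / 16) (hmB : η * m * B ≤ 1 / 16) (hD : 0 ≤ D)
    (hk : 2 * A * (m * α) ^ 2 + 2 * (A * B) * m ^ 2 * D = k) (hg : g ≤ k) :
    η ^ 2 * g ≤ η * (m * α ^ 2) / 8 + D / 128 := by
  have h1 : η ^ 2 * g ≤ η ^ 2 * k := mul_le_mul_of_nonneg_left hg (by positivity)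
  have h2 : η * m * A * (η * m * B) ≤ 1 / 16 * (1 / 16) :=
    mul_le_mul hmA hmB (by positivity) (by norm_num)
  have h3 := mul_le_mul_of_nonneg_right h2 hD
  have h4 := mul_le_mul_of_nonneg_right hmA (show 0 ≤ η * m * α ^ 2 by positivity)
  rw [← hk] at h1
  nlinarith

theorem avgPolicy_apply (T₁ T₂ : ℕ) (h : T₁ ≤ T₂) (s : Fin nS) :
    G.avgPolicy η xin yin T₁ T₂ s =
      pairVec (G.avgX η xin yin (T₂ - T₁) s : EuclideanSpace ℝ (Fin nA))
        (G.avgY η xin yin (T₂ - T₁) s) := by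
  obtain ⟨n, rfl⟩ := Nat.exists_eq_add_of_le h
  have hr : Finset.Icc T₁ (T₁ + n) = (Finset.range (n + 1)).map (addLeftEmbedding T₁) := by
    rw [Finset.range_eq_Ico, Finset.map_add_left_Ico]
    ext; simp; omega
  change ∑ t ∈ Finset.Icc T₁ (T₁ + n), _ = _
  rw [hr, Finset.sum_map]
  simp only [addLeftEmbedding_apply, Nat.add_sub_cancel_left]
  apply (WithLp.linearEquiv 2 ℝ _).injective
  rw [map_sum]
  refine Prod.ext ?_ ?_
  · rw [Prod.fst_sum]
    ext a
    rw [WithLp.ofLp_sum, Finset.sum_apply]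
    rfl
  · rw [Prod.snd_sum]
    ext a
    rw [WithLp.ofLp_sum, Finset.sum_apply]
    rfl

variable [NeZero nS]

theorem regret_succ_le (hη : 0 < η) (hηA : η * (1 / (1 - G.γ)) * nA ≤ 1 / 16)
    (hηB : η * (1 / (1 - G.γ)) * nB ≤ 1 / 16) (s : Fin nS) (a : Fin nA) (b : Fin nB) (t : ℕ) :
    G.regret η xin yin s a b (t + 1) ≤
      G.potential η xin yin s a b t - G.potential η xin yin s a b (t + 1) := by
  have hm := G.one_le_inv_one_sub_gamma
  have hH := G.one_le_horizon
  have hH2 := G.horizon_add_one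
  have hx := G.optimistic_step_x η xin yin s (vertex a) t
  have hy := G.optimistic_step_y η xin yin s (vertex b) t
  have hqx := second_order_le hη hm (Nat.cast_nonneg nB) hηA hηB
    (sq_nonneg _) rfl
    (G.norm_sq_qLo_sub_le (G.aogda_Vlo_mem_Icc η xin yin t)
      (G.abs_aogda_Vlo_succ_sub_le η xin yin t)
      (G.aogda η xin yin t).y (G.aogda η xin yin (t + 1)).y s)
  have hqy := second_order_le hη hm (Nat.cast_nonneg nA) hηB hηA
    (sq_nonneg _) rfl
    (G.norm_sq_qHi_sub_le (G.aogda_Vhi_mem_Icc η xin yin t)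
      (G.abs_aogda_Vhi_succ_sub_le η xin yin t)
      (G.aogda η xin yin t).x (G.aogda η xin yin (t + 1)).x s)
  -- The movement of the played policy is measured through the auxiliary point at time `t`. With the
  -- factor `1/128` it costs `1/64` of the old squared distance, held in the potential, and `1/64`
  -- of the new one, covered by the negative terms of the step.
  have hdx := norm_sub_sq_le_two_mul
    ((G.aogda η xin yin (t + 1)).x s : EuclideanSpace ℝ (Fin nA))
    ((G.aogda η xin yin t).x s) ((G.aogda η xin yin t).xt s)
  have hdy := norm_sub_sq_le_two_mul
    ((G.aogda η xin yin (t + 1)).y s : EuclideanSpace ℝ (Fin nB))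
    ((G.aogda η xin yin t).y s) ((G.aogda η xin yin t).yt s)
  -- The two players' drift terms, `η m α²/8` each with `m = 1/(1-γ)`, add up to `η` times this left
  -- side. As `α_{t+1} = 2m/(H+t+1)`, it equals `m³/(H+t+1)²`, which telescopes.
  have hα : 1 / (1 - G.γ) * alphaStep G.horizon (t + 1) ^ 2 / 4 ≤
      (1 / (1 - G.γ)) ^ 3 / (G.horizon + t) - (1 / (1 - G.γ)) ^ 3 / (G.horizon + (t + 1 : ℕ)) := by
    have hp : 0 < G.horizon + t := by positivity
    have hq : 0 < G.horizon + (t + 1) := by positivity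
    have e1 : 1 / (1 - G.γ) * alphaStep G.horizon (t + 1) ^ 2 / 4 =
        (1 / (1 - G.γ)) ^ 3 / ((G.horizon + (t + 1)) * (G.horizon + (t + 1))) := by
      unfold alphaStep
      rw [hH2]
      push_cast
      rw [div_pow, mul_pow]
      ring
    have e2 : (1 / (1 - G.γ)) ^ 3 / (G.horizon + t) -
        (1 / (1 - G.γ)) ^ 3 / (G.horizon + (t + 1 : ℕ)) =
        (1 / (1 - G.γ)) ^ 3 / ((G.horizon + t) * (G.horizon + (t + 1))) := by
      push_cast
      rw [div_sub_div _ _ hp.ne' hq.ne']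
      ring
    rw [e1, e2]
    refine div_le_div_of_nonneg_left (by positivity) (by positivity) ?_
    exact mul_le_mul_of_nonneg_right (by linarith) hq.le
  have hα' := mul_le_mul_of_nonneg_left hα hη.le
  have hn1 := sq_nonneg ‖((G.aogda η xin yin (t + 1)).x s : EuclideanSpace ℝ (Fin nA)) -
    (G.aogda η xin yin (t + 1)).xt s‖
  have hn2 := sq_nonneg ‖((G.aogda η xin yin (t + 1)).y s : EuclideanSpace ℝ (Fin nB)) -
    (G.aogda η xin yin (t + 1)).yt s‖
  have hn3 := sq_nonneg ‖((G.aogda η xin yin (t + 1)).x s : EuclideanSpace ℝ (Fin nA)) -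
    (G.aogda η xin yin t).xt s‖
  have hn4 := sq_nonneg ‖((G.aogda η xin yin (t + 1)).y s : EuclideanSpace ℝ (Fin nB)) -
    (G.aogda η xin yin t).yt s‖
  refine le_of_mul_le_mul_left ?_ hη
  unfold regret potential
  rw [mul_sub, mul_sub, mul_add, mul_add, mul_div_cancel₀ _ hη.ne', mul_div_cancel₀ _ hη.ne']
  linarith

theorem regret_zero_le (s : Fin nS) (a : Fin nA) (b : Fin nB) :
    G.regret η xin yin s a b 0 ≤ 2 * (1 / (1 - G.γ)) := by
  have h1 := G.qHi_mem_Icc (G.aogda_Vhi_mem_Icc η xin yin 0) (G.aogda η xin yin 0).x s b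
  have h2 := G.qLo_mem_Icc (G.aogda_Vlo_mem_Icc η xin yin 0) (G.aogda η xin yin 0).y s a
  have h3 := bilin_nonneg (fun a b => (G.bellman_mem_Icc (G.aogda_Vhi_mem_Icc η xin yin 0) s a b).1)
    ((G.aogda η xin yin 0).x s) ((G.aogda η xin yin 0).y s)
  have h4 := bilin_le_of_le
    (fun a b => (G.bellman_mem_Icc (G.aogda_Vlo_mem_Icc η xin yin 0) s a b).2)
    ((G.aogda η xin yin 0).x s) ((G.aogda η xin yin 0).y s)
  rw [regret_eq]
  linarith [h1.2, h2.1]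

theorem wavg_regret_le (hη : 0 < η) (hηA : η * (1 / (1 - G.γ)) * nA ≤ 1 / 16)
    (hηB : η * (1 / (1 - G.γ)) * nB ≤ 1 / 16) (s : Fin nS) (a : Fin nA) (b : Fin nB) (t : ℕ) :
    wavg G.horizon (G.regret η xin yin s a b) (t + 1) ≤
      8 * (1 / (1 - G.γ)) ^ 2 / η / (G.horizon + (t + 1)) := by
  have hm := G.one_le_inv_one_sub_gamma
  have hH := G.one_le_horizon
  have h := wavg_le_of_potential hH (by linarith) (G.regret_zero_le η xin yin s a b)
    (G.potential_le η xin yin hη s a b) (G.regret_succ_le η xin yin hη hηA hηB s a b) t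
  have h0 := G.potential_nonneg η xin yin hη s a b t
  have hA : (1 : ℝ) ≤ nA := by exact_mod_cast NeZero.one_le
  have hηm : η * (1 / (1 - G.γ)) ≤ 1 / 16 := by
    refine le_trans ?_ hηA
    exact le_mul_of_one_le_right (by positivity) hA
  set m := 1 / (1 - G.γ) with hmdef
  -- Here `η m ≤ 1/16` lets `3/η` dominate the other two terms, up to `4m/η`.
  have hR : 2 * m + (3 / η + m ^ 2) ≤ 4 * m / η := by
    rw [le_div_iff₀ hη]
    have : (2 * m + (3 / η + m ^ 2)) * η = 2 * (η * m) + 3 + (η * m) * m := by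
      field_simp
      ring
    rw [this]
    nlinarith
  calc _ ≤ _ := h
    _ ≤ alphaStep G.horizon (t + 1) * (4 * m / η) :=
        mul_le_mul_of_nonneg_left (by linarith) (alphaStep_pos hH _).le
    _ = 8 * m ^ 2 / η / (G.horizon + (t + 1)) := by
        unfold alphaStep
        rw [G.horizon_add_one]
        push_cast
        ring

theorem valueGap_succ_le (hη : 0 < η) (hηA : η * (1 / (1 - G.γ)) * nA ≤ 1 / 16)
    (hηB : η * (1 / (1 - G.γ)) * nB ≤ 1 / 16) (t : ℕ) :
    G.valueGap η xin yin (t + 1) ≤ 24 * (1 / (1 - G.γ)) ^ 3 / (η * (t + 1)) := by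
  have hm := G.one_le_inv_one_sub_gamma
  have hH := G.one_le_horizon
  have hA : (1 : ℝ) ≤ nA := by exact_mod_cast NeZero.one_le
  have hηm : η * (1 / (1 - G.γ)) ≤ 1 / 16 := by
    refine le_trans ?_ hηA
    exact le_mul_of_one_le_right (by positivity) hA
  have hrec : ∀ t : ℕ, G.valueGap η xin yin (t + 1) ≤
      G.γ * wavg G.horizon (G.valueGap η xin yin) (t + 1) +
        8 * (1 / (1 - G.γ)) ^ 2 / η / (G.horizon + (t + 1)) := by
    intro t
    obtain ⟨s, a, b, h⟩ := G.exists_valueGap_succ_le η xin yin t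
    exact h.trans (add_le_add le_rfl (G.wavg_regret_le η xin yin hη hηA hηB s a b t))
  have h0 : G.valueGap η xin yin 0 ≤ 8 * (1 / (1 - G.γ)) ^ 2 / η := by
    refine ciSup_le fun s => ?_
    have h1 := G.aogda_Vhi_mem_Icc η xin yin 0 s
    have h2 := G.aogda_Vlo_mem_Icc η xin yin 0 s
    rw [le_div_iff₀ hη]
    have h3 : ((G.aogda η xin yin 0).Vhi s - (G.aogda η xin yin 0).Vlo s) * η ≤
        1 / (1 - G.γ) * η := mul_le_mul_of_nonneg_right (by linarith [h1.2, h2.1]) hη.le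
    nlinarith
  have hγ : (G.horizon + 1) * (1 - G.γ) = 2 := by
    have := G.one_sub_gamma_pos.ne'
    rw [G.horizon_add_one]
    field_simp
  have hS := wavg_le_of_recursion hH hγ h0 hrec t
  have hS' := mul_le_mul_of_nonneg_left hS G.γ_nonneg
  set m := 1 / (1 - G.γ) with hmdef
  have hq : 0 < G.horizon + (t + 1) := by positivity
  have hM : 0 ≤ (G.horizon + 1) * (8 * m ^ 2 / η) / (G.horizon + (t + 1)) := by positivity
  have hγ1 := mul_le_of_le_one_left hM G.γ_lt_one.le
  -- With `H+1 = 2m`, the averaged gap contributes `16 m³` and the regret `8 m² ≤ 8 m³`, whence 24.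
  calc G.valueGap η xin yin (t + 1)
      ≤ (G.horizon + 1) * (8 * m ^ 2 / η) / (G.horizon + (t + 1)) +
        8 * m ^ 2 / η / (G.horizon + (t + 1)) := by linarith [hrec t]
    _ = (16 * m ^ 3 + 8 * m ^ 2) / (η * (G.horizon + (t + 1))) := by
        rw [G.horizon_add_one]
        field_simp
        ring
    _ ≤ 24 * m ^ 3 / (η * (t + 1)) := by
        refine div_le_div₀ (by positivity) ?_ (by positivity) ?_
        · nlinarith [mul_le_mul_of_nonneg_left hm (sq_nonneg m)]
        · exact mul_le_mul_of_nonneg_left (by linarith) hη.le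

/-! ### From statewise gaps to the distance to equilibrium -/

theorem infDist_zStar_le (z : JointSpace nS nA nB) {d : ℝ}
    (h : ∀ s, Metric.infDist (z s) (G.zStarAt s) ≤ d) :
    Metric.infDist z G.zStar ≤ Real.sqrt nS * d := by
  obtain ⟨e, he⟩ := G.zStar_nonempty
  -- Nearly closest points with slack `ε` avoid any appeal to attainment of the distance;
  -- nonemptiness is needed since `infDist` to the empty set is 0.
  have key : ∀ ε : ℝ, 0 < ε → Metric.infDist z G.zStar ≤ Real.sqrt nS * (d + ε) := by
    intro ε hε
    have hex : ∀ s, ∃ p ∈ G.zStarAt s, dist (z s) p < d + ε := fun s =>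
      (Metric.infDist_lt_iff ⟨e s, he s⟩).1 (by linarith [h s])
    choose p hp hlt using hex
    have hpos : 0 ≤ d + ε := by
      have := (dist_nonneg.trans_lt (hlt 0)).le
      exact this
    refine (Metric.infDist_le_dist_of_mem (s := G.zStar) (y := WithLp.toLp 2 p) hp).trans ?_
    rw [PiLp.dist_eq_of_L2, ← Real.sqrt_sq hpos, ← Real.sqrt_mul (Nat.cast_nonneg nS)]
    refine Real.sqrt_le_sqrt ?_
    calc ∑ s, dist (z s) (p s) ^ 2 ≤ ∑ _s : Fin nS, (d + ε) ^ 2 :=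
          Finset.sum_le_sum fun s _ => pow_le_pow_left₀ dist_nonneg (hlt s).le 2
      _ = nS * (d + ε) ^ 2 := by simp
  have hS : 0 < Real.sqrt nS := Real.sqrt_pos.2 (by exact_mod_cast NeZero.pos nS)
  refine le_of_forall_pos_le_add fun ε hε => ?_
  have := key (ε / Real.sqrt nS) (by positivity)
  rwa [mul_add, mul_div_cancel₀ _ hS.ne'] at this

theorem infDist_avgPolicy_le {c : ℝ} (hc : 0 < c) (hG : G.IsErrorBound c) {T₁ T₂ : ℕ} (hT : T₁ < T₂)
    (hη : 0 < η) (hη' : η ≤ (1 - G.γ) / (16 * max (nA : ℝ) (nB : ℝ))) :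
    Metric.infDist (G.avgPolicy η xin yin T₁ T₂) G.zStar ≤
      Real.sqrt nS * (24 * (1 / (1 - G.γ)) ^ 3 / (η * ((T₂ : ℝ) - T₁ + 1)) / c) := by
  have hpos := G.one_sub_gamma_pos
  have hA : (0 : ℝ) < nA := by exact_mod_cast NeZero.pos nA
  have hmax : (0 : ℝ) < max (nA : ℝ) nB := lt_max_of_lt_left hA
  have hηmax : η * (1 / (1 - G.γ)) * max (nA : ℝ) nB ≤ 1 / 16 := by
    rw [le_div_iff₀ (by positivity)] at hη'
    rw [mul_one_div, div_mul_eq_mul_div, div_le_iff₀ hpos]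
    linarith
  have hηA : η * (1 / (1 - G.γ)) * nA ≤ 1 / 16 :=
    (mul_le_mul_of_nonneg_left (le_max_left _ _) (by positivity)).trans hηmax
  have hηB : η * (1 / (1 - G.γ)) * nB ≤ 1 / 16 :=
    (mul_le_mul_of_nonneg_left (le_max_right _ _) (by positivity)).trans hηmax
  refine G.infDist_zStar_le _ fun s => ?_
  rw [G.avgPolicy_apply η xin yin T₁ T₂ hT.le, le_div_iff₀ hc, mul_comm]
  have h1 := hG (G.avgX η xin yin (T₂ - T₁)) (G.avgY η xin yin (T₂ - T₁)) s
  have h2 := G.gap_avg_le η xin yin (T₂ - T₁) s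
  have h3 := G.le_valueGap η xin yin (T₂ - T₁ + 1) s
  have h4 := G.valueGap_succ_le η xin yin hη hηA hηB (T₂ - T₁)
  rw [Nat.cast_sub hT.le] at h4
  linarith

end MarkovGame

end

theorem theorem3 :
    ∃ K : ℝ, 0 < K ∧
      ∀ (nS nA nB : ℕ) [NeZero nS] [NeZero nA] [NeZero nB] (G : MarkovGame nS nA nB),
        (∃ c : ℝ, 0 < c ∧ G.IsErrorBound c) ∧
        ∀ c : ℝ, 0 < c → G.IsErrorBound c →
          ∃ C : ℝ, 0 < C ∧
            C ≤ K * (Real.sqrt (nS : ℝ) * ((nA : ℝ) + (nB : ℝ)) / (c * (1 - G.γ) ^ 6)) ∧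
            ∀ (T₁ T₂ : ℕ), T₁ < T₂ →
              ∀ (xin : Policy nS nA) (yin : Policy nS nB) (η : ℝ), 0 < η →
                η ≤ (1 - G.γ) / (16 * max (nA : ℝ) (nB : ℝ)) →
                Metric.infDist (G.avgPolicy η xin yin T₁ T₂) G.zStar ≤
                  C * Real.log ((T₂ : ℝ) - (T₁ : ℝ) + 1) /
                    (η * ((T₂ : ℝ) - (T₁ : ℝ) + 1)) := by
  -- The constant 48 is twice 24, since `log (T₂ - T₁ + 1) ≥ log 2 ≥ 1/2`.
  refine ⟨48, by norm_num, fun nS nA nB _ _ _ G => ⟨G.exists_isErrorBound, fun c hc hG => ?_⟩⟩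
  have hpos := G.one_sub_gamma_pos
  have hm := G.one_le_inv_one_sub_gamma
  have hS : (0 : ℝ) < Real.sqrt nS := Real.sqrt_pos.2 (by exact_mod_cast NeZero.pos nS)
  have hA : (1 : ℝ) ≤ nA := by exact_mod_cast NeZero.one_le
  have hB : (1 : ℝ) ≤ nB := by exact_mod_cast NeZero.one_le
  -- `C` is the largest value allowed; the spare factors `A + B` and `(1-γ)^{-3}` are at least 1.
  refine ⟨_, by positivity, le_rfl, fun T₁ T₂ hT xin yin η hη hη' => ?_⟩
  refine (G.infDist_avgPolicy_le η xin yin hc hG hT hη hη').trans ?_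
  have hT' : (1 : ℝ) ≤ T₂ - T₁ := by
    have : (T₁ : ℝ) + 1 ≤ T₂ := by exact_mod_cast hT
    linarith
  have hlog : 1 / 2 ≤ Real.log ((T₂ : ℝ) - T₁ + 1) :=
    le_trans (by linarith [Real.log_two_gt_d9]) (Real.log_le_log two_pos (by linarith))
  have hn : 0 < (T₂ : ℝ) - T₁ + 1 := by linarith
  have hC : 24 * (1 / (1 - G.γ)) ^ 3 ≤ 48 * (((nA : ℝ) + nB) * (1 / (1 - G.γ)) ^ 6) *
      Real.log ((T₂ : ℝ) - T₁ + 1) := by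
    have h1 : (1 / (1 - G.γ)) ^ 3 ≤ (1 / (1 - G.γ)) ^ 6 := pow_le_pow_right₀ hm (by norm_num)
    have h2 : (1 / (1 - G.γ)) ^ 6 ≤ ((nA : ℝ) + nB) * (1 / (1 - G.γ)) ^ 6 :=
      le_mul_of_one_le_left (by positivity) (by linarith)
    nlinarith [mul_le_mul_of_nonneg_left hlog
      (show 0 ≤ ((nA : ℝ) + nB) * (1 / (1 - G.γ)) ^ 6 by positivity)]
  calc Real.sqrt nS * (24 * (1 / (1 - G.γ)) ^ 3 / (η * ((T₂ : ℝ) - T₁ + 1)) / c)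
      ≤ Real.sqrt nS * (48 * (((nA : ℝ) + nB) * (1 / (1 - G.γ)) ^ 6) *
        Real.log ((T₂ : ℝ) - T₁ + 1) / (η * ((T₂ : ℝ) - T₁ + 1)) / c) := by gcongr
    _ = _ := by
        field_simp
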